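/- Let $F$ be a field of characteristic $0$. Algebras over $F$ are not assumed associative or unital. A superalgebra is an algebra $A=A_0\oplus A_1$ with $A_iA_j\subseteq A_{i+j \bmod 2}$. Its Grassmann envelope is the subalgebra $G(A)=G_0\otimes A_0+G_1\otimes A_1$ of $G\otimes A$, where $G=G_0\oplus G_1$ is the Grassmann algebra on countably many generators with its $\mathbb Z_2$-grading by parity of length. A variety $\mathcal V$ is the class of all algebras satisfying a given set of polynomial identities; the variety generated by an algebra is the smallest variety containing it. A $\mathcal V$-superalgebra is a superalgebra $A$ with $G(A)\in\mathcal V$, and $\widetilde{\mathcal V}$ denotes the class of all $\mathcal V$-superalgebras. A supervariety is a class of the form $\widetilde{\mathcal V}$ for a variety $\mathcal V$; the supervariety generated by a superalgebra is the smallest supervariety containing it. For $(r,s)\in\mathbb Z_{\ge0}^2$, $(r,s)\neq(0,0)$, let $\mathcal V_{r,s}$ be the supervariety generated by the free $\mathcal V$-superalgebra on $r$ even and $s$ odd generators, and let $\mathcal V_{0,0}$ consist of the zero superalgebra only. A pair $(r,s)$ is a basic superrank of $\mathcal V$ if $\mathcal V_{r,s}=\widetilde{\mathcal V}$ and $(r,s)$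 is minimal with this property: there is no $(r',s')\ne(r,s)$ with $r'\le r$, $s'\le s$ and $\mathcal V_{r',s'}=\widetilde{\mathcal V}$. Let $\mathfrak M$ be the variety of all metabelian algebras over $F$, defined by the identity $(xy)(zt)=0$. **Corollary.** Let $(r,s)\neq(0,0)$ be a pair of nonnegative integers, let $\mathfrak A_{r,s}$ be the free $\mathfrak M$-superalgebra (free metabelian superalgebra) on $r$ even and $s$ odd generators, and let $\mathfrak N$ be the variety generated by its Grassmann envelope $G(\mathfrak A_{r,s})$. Then $(r,s)$ is a basic superrank of $\mathfrak N$, and $\mathfrak N$ has no other basic superrank. -/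

import Mathlib

open scoped TensorProduct

universe u

namespace Superrank

/-- A (not necessarily associative, not necessarily unital) algebra over the field `F`. -/
structure Alg (F : Type u) [Field F] : Type (u + 1) where
  carrier : Type u
  [ring : NonUnitalNonAssocRing carrier]
  [module : Module F carrier]
  [tower : IsScalarTower F carrier carrier]
  [comm : SMulCommClass F carrier carrier]

attribute [instance] Alg.ring Alg.module Alg.tower Alg.comm

/-- A superalgebra over `F`: an algebra `A = A₀ ⊕ A₁` with `Aᵢ Aⱼ ⊆ Aᵢ₊ⱼ`, indices mod 2. -/
structure SuperAlg (F : Type u) [Field F] extends Alg F where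
  part : ZMod 2 → Submodule F carrier
  isCompl : IsCompl (part 0) (part 1)
  mul_mem : ∀ {i j : ZMod 2} {a b : carrier}, a ∈ part i → b ∈ part j → a * b ∈ part (i + j)

section Varieties

variable {F : Type u} [Field F]

/-- The algebra `A` satisfies the identity `f = 0`, where `f` is a nonassociative polynomial
in the variables `x₀, x₁, x₂, …`. -/
def Alg.Satisfies (A : Alg F) (f : FreeNonUnitalNonAssocAlgebra F ℕ) : Prop :=
  ∀ v : ℕ → A.carrier, FreeNonUnitalNonAssocAlgebra.lift F v f = 0

/-- A variety: the class of all algebras satisfying some set of identities. -/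
def IsVariety (V : Set (Alg F)) : Prop :=
  ∃ S : Set (FreeNonUnitalNonAssocAlgebra F ℕ), V = {A | ∀ f ∈ S, A.Satisfies f}

/-- The variety generated by an algebra: the smallest variety containing it. -/
def varietyGenerated (A : Alg F) : Set (Alg F) :=
  ⋂₀ {V | IsVariety V ∧ A ∈ V}

/-- The class of all metabelian algebras, given by the identity `(xy)(zt) = 0`. -/
def metabelian (F : Type u) [Field F] : Set (Alg F) :=
  {A | ∀ x y z t : A.carrier, (x * y) * (z * t) = 0}

end Varieties

section GrassmannEnvelope

variable {F : Type u} [Field F]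

/-- The Grassmann algebra on countably many generators. -/
noncomputable abbrev Grassmann (F : Type u) [Field F] : Type u := ExteriorAlgebra F (ℕ →₀ F)

/-- The even (`i = 0`) and odd (`i = 1`) parts of the Grassmann algebra, spanned by the words
of even and of odd length in the generators. -/
noncomputable abbrev Grassmann.part (F : Type u) [Field F] (i : ZMod 2) : Submodule F (Grassmann F) :=
  CliffordAlgebra.evenOdd (0 : QuadraticForm F (ℕ →₀ F)) i

/-- The subspace `G₀ ⊗ A₀ + G₁ ⊗ A₁` of `G ⊗ A`. -/
noncomputable def SuperAlg.envelopeSubmodule (A : SuperAlg F) : Submodule F (Grassmann F ⊗[F] A.carrier) :=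
  ⨆ i : ZMod 2, Submodule.map₂ (TensorProduct.mk F (Grassmann F) A.carrier)
    (Grassmann.part F i) (A.part i)

theorem SuperAlg.mul_mem_envelope (A : SuperAlg F) {x y : Grassmann F ⊗[F] A.carrier}
    (hx : x ∈ A.envelopeSubmodule) (hy : y ∈ A.envelopeSubmodule) :
    x * y ∈ A.envelopeSubmodule := by
  have key : ∀ i j : ZMod 2, ∀ g ∈ Grassmann.part F i, ∀ a ∈ A.part i,
      ∀ h ∈ Grassmann.part F j, ∀ b ∈ A.part j,
      (g ⊗ₜ[F] a) * (h ⊗ₜ[F] b) ∈ A.envelopeSubmodule := by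
    intro i j g hg a ha h hh b hb
    rw [Algebra.TensorProduct.tmul_mul_tmul]
    refine Submodule.mem_iSup_of_mem (i + j) (Submodule.apply_mem_map₂ _ ?_ (A.mul_mem ha hb))
    exact CliffordAlgebra.evenOdd_mul_le _ i j (Submodule.mul_mem_mul hg hh)
  have h1 : ∀ i : ZMod 2, ∀ g ∈ Grassmann.part F i, ∀ a ∈ A.part i,
      A.envelopeSubmodule ≤ A.envelopeSubmodule.comap (LinearMap.mulLeft F (g ⊗ₜ[F] a)) := by
    intro i g hg a ha
    refine iSup_le fun j => Submodule.map₂_le.2 fun h hh b hb => ?_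
    exact key i j g hg a ha h hh b hb
  have h2 : A.envelopeSubmodule ≤ A.envelopeSubmodule.comap (LinearMap.mulRight F y) := by
    refine iSup_le fun i => Submodule.map₂_le.2 fun g hg a ha => ?_
    exact h1 i g hg a ha hy
  exact h2 hx

/-- The Grassmann envelope `G(A) = G₀ ⊗ A₀ + G₁ ⊗ A₁`, a subalgebra of `G ⊗ A`. -/
noncomputable def SuperAlg.envelopeSubalgebra (A : SuperAlg F) :
    NonUnitalSubalgebra F (Grassmann F ⊗[F] A.carrier) :=
  { A.envelopeSubmodule with mul_mem' := A.mul_mem_envelope }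

/-- The Grassmann envelope as an algebra. -/
noncomputable def SuperAlg.envelope (A : SuperAlg F) : Alg F where
  carrier := A.envelopeSubalgebra

end GrassmannEnvelope

section Supervarieties

variable {F : Type u} [Field F]

/-- The class `Ṽ` of all `V`-superalgebras: those whose Grassmann envelope lies in `V`. -/
def superClass (V : Set (Alg F)) : Set (SuperAlg F) :=
  {A | A.envelope ∈ V}

/-- A supervariety: the class of all `V`-superalgebras for some variety `V`. -/
def IsSupervariety (W : Set (SuperAlg F)) : Prop :=
  ∃ V : Set (Alg F), IsVariety V ∧ W = superClass V

/-- The supervariety generated by a superalgebra: the smallest supervariety containing it. -/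
def supervarietyGenerated (A : SuperAlg F) : Set (SuperAlg F) :=
  ⋂₀ {W | IsSupervariety W ∧ A ∈ W}

end Supervarieties

section Quotients

variable {F : Type u} [Field F]

/-- A graded two-sided ideal of a superalgebra. -/
structure SuperIdeal (A : SuperAlg F) where
  toSubmodule : Submodule F A.carrier
  mul_left : ∀ (a : A.carrier) {x : A.carrier}, x ∈ toSubmodule → a * x ∈ toSubmodule
  mul_right : ∀ (a : A.carrier) {x : A.carrier}, x ∈ toSubmodule → x * a ∈ toSubmodule
  homogeneous : ∀ {x y : A.carrier}, x ∈ A.part 0 → y ∈ A.part 1 →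
    x + y ∈ toSubmodule → x ∈ toSubmodule ∧ y ∈ toSubmodule

namespace SuperIdeal

variable {A : SuperAlg F}

/-- The underlying space of the quotient superalgebra `A / I`. -/
def Quot (I : SuperIdeal A) : Type u := A.carrier ⧸ I.toSubmodule

noncomputable instance (I : SuperIdeal A) : AddCommGroup I.Quot :=
  inferInstanceAs (AddCommGroup (A.carrier ⧸ I.toSubmodule))

noncomputable instance (I : SuperIdeal A) : Module F I.Quot :=
  inferInstanceAs (Module F (A.carrier ⧸ I.toSubmodule))

/-- The canonical projection `A → A / I`. -/
def proj (I : SuperIdeal A) : A.carrier →ₗ[F] I.Quot := I.toSubmodule.mkQ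

theorem proj_surjective (I : SuperIdeal A) : Function.Surjective I.proj :=
  I.toSubmodule.mkQ_surjective

theorem proj_eq_zero (I : SuperIdeal A) {x : A.carrier} :
    I.proj x = 0 ↔ x ∈ I.toSubmodule :=
  Submodule.Quotient.mk_eq_zero I.toSubmodule

theorem mul_congr (I : SuperIdeal A) {a a' b b' : A.carrier} (ha : I.proj a = I.proj a')
    (hb : I.proj b = I.proj b') : I.proj (a * b) = I.proj (a' * b') := by
  rw [← sub_eq_zero, ← map_sub, proj_eq_zero] at ha hb ⊢
  have h : a * b - a' * b' = (a - a') * b + a' * (b - b') := by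
    rw [sub_mul, mul_sub]; abel
  rw [h]
  exact add_mem (I.mul_right _ ha) (I.mul_left _ hb)

/-- The multiplication `(a + I)(b + I) = ab + I` of the quotient. -/
noncomputable instance (I : SuperIdeal A) : Mul I.Quot where
  mul x y := Quotient.liftOn₂' x y (fun a b => I.proj (a * b))
    (fun _ _ _ _ ha hb => I.mul_congr (Quotient.sound' ha) (Quotient.sound' hb))

theorem proj_mul (I : SuperIdeal A) (a b : A.carrier) :
    I.proj (a * b) = I.proj a * I.proj b := rfl

noncomputable instance (I : SuperIdeal A) : NonUnitalNonAssocRing I.Quot where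
  left_distrib x y z := by
    obtain ⟨a, rfl⟩ := I.proj_surjective x
    obtain ⟨b, rfl⟩ := I.proj_surjective y
    obtain ⟨c, rfl⟩ := I.proj_surjective z
    rw [← map_add, ← proj_mul, ← proj_mul, ← proj_mul, ← map_add, mul_add]
  right_distrib x y z := by
    obtain ⟨a, rfl⟩ := I.proj_surjective x
    obtain ⟨b, rfl⟩ := I.proj_surjective y
    obtain ⟨c, rfl⟩ := I.proj_surjective z
    rw [← map_add, ← proj_mul, ← proj_mul, ← proj_mul, ← map_add, add_mul]
  zero_mul x := by
    obtain ⟨a, rfl⟩ := I.proj_surjective x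
    rw [← map_zero I.proj, ← proj_mul, zero_mul]
  mul_zero x := by
    obtain ⟨a, rfl⟩ := I.proj_surjective x
    rw [← map_zero I.proj, ← proj_mul, mul_zero]

instance (I : SuperIdeal A) : IsScalarTower F I.Quot I.Quot where
  smul_assoc c x y := by
    obtain ⟨a, rfl⟩ := I.proj_surjective x
    obtain ⟨b, rfl⟩ := I.proj_surjective y
    simp only [smul_eq_mul, ← map_smul, ← proj_mul, smul_mul_assoc]

instance (I : SuperIdeal A) : SMulCommClass F I.Quot I.Quot where
  smul_comm c x y := by
    obtain ⟨a, rfl⟩ := I.proj_surjective x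
    obtain ⟨b, rfl⟩ := I.proj_surjective y
    simp only [smul_eq_mul, ← map_smul, ← proj_mul, mul_smul_comm]

/-- The quotient superalgebra `A / I`, graded by the images of `A₀` and `A₁`. -/
noncomputable def quotient (I : SuperIdeal A) : SuperAlg F where
  carrier := I.Quot
  part i := (A.part i).map I.proj
  isCompl := by
    constructor
    · rw [Submodule.disjoint_def]
      rintro _ ⟨a, ha, rfl⟩ ⟨b, hb, hab⟩
      rw [proj_eq_zero]
      refine (I.homogeneous ha ((A.part 1).neg_mem hb) ?_).1
      rw [← proj_eq_zero, map_add, map_neg, hab, add_neg_cancel]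
    · rw [codisjoint_iff, ← Submodule.map_sup, A.isCompl.sup_eq_top, Submodule.map_top,
        LinearMap.range_eq_top]
      exact I.proj_surjective
  mul_mem := by
    rintro i j _ _ ⟨a, ha, rfl⟩ ⟨b, hb, rfl⟩
    exact ⟨a * b, A.mul_mem ha hb, I.proj_mul a b⟩

/-- The intersection of a family of graded ideals (the whole algebra for the empty family). -/
def sInf (T : Set (SuperIdeal A)) : SuperIdeal A where
  toSubmodule := ⨅ J ∈ T, J.toSubmodule
  mul_left a x hx := by
    simp only [Submodule.mem_iInf] at hx ⊢
    exact fun J hJ => J.mul_left a (hx J hJ)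
  mul_right a x hx := by
    simp only [Submodule.mem_iInf] at hx ⊢
    exact fun J hJ => J.mul_right a (hx J hJ)
  homogeneous hx hy hxy := by
    simp only [Submodule.mem_iInf] at hxy ⊢
    exact ⟨fun J hJ => (J.homogeneous hx hy (hxy J hJ)).1,
      fun J hJ => (J.homogeneous hx hy (hxy J hJ)).2⟩

end SuperIdeal

end Quotients

section Free

/-- The parity of a nonassociative word in even letters from `X` and odd letters from `Y`:
the number of its odd letters mod 2. -/
def parity {X Y : Type} : FreeMagma (X ⊕ Y) → ZMod 2
  | .of (.inl _) => 0
  | .of (.inr _) => 1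
  | .mul a b => parity a + parity b

theorem parity_mul {X Y : Type} (a b : FreeMagma (X ⊕ Y)) :
    parity (a * b) = parity a + parity b := rfl

/-- The absolutely free superalgebra on a set `X` of even and a set `Y` of odd generators. -/
noncomputable def absFree (F : Type u) [Field F] (X Y : Type) : SuperAlg F where
  carrier := FreeNonUnitalNonAssocAlgebra F (X ⊕ Y)
  part i := MonoidAlgebra.supported F F {w | parity w = i}
  isCompl := by
    constructor
    · rw [Submodule.disjoint_def]
      intro x h0 h1
      rw [MonoidAlgebra.mem_supported'] at h0 h1
      ext w
      by_cases hw : parity w = 0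
      · exact h1 w (by simp [hw])
      · exact h0 w (by simpa using hw)
    · rw [codisjoint_iff, eq_top_iff]
      intro x _
      induction x using MonoidAlgebra.induction_linear with
      | zero => exact zero_mem _
      | add x y hx hy => exact add_mem (hx trivial) (hy trivial)
      | single w c =>
        have h : parity w = 0 ∨ parity w = 1 := by
          generalize parity w = p
          revert p
          decide
        have hs : ∀ i, parity w = i →
            (MonoidAlgebra.single w c : FreeNonUnitalNonAssocAlgebra F (X ⊕ Y)) ∈
              MonoidAlgebra.supported F F {w : FreeMagma (X ⊕ Y) | parity w = i} := by
          intro i hi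
          rw [MonoidAlgebra.mem_supported']
          intro m hm
          rw [MonoidAlgebra.coeff_single]
          refine Finsupp.single_eq_of_ne ?_
          rintro rfl
          exact hm hi
        rcases h with h | h
        · exact Submodule.mem_sup_left (hs 0 h)
        · exact Submodule.mem_sup_right (hs 1 h)
  mul_mem := by
    intro i j a b ha hb
    rw [MonoidAlgebra.supported_eq_span_single] at ha hb
    induction ha, hb using Submodule.span_induction₂ with
    | mem_mem x y hx hy =>
      obtain ⟨w, hw, rfl⟩ := hx
      obtain ⟨w', hw', rfl⟩ := hy
      rw [MonoidAlgebra.supported_eq_span_single]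
      refine Submodule.subset_span ⟨w * w', ?_, ?_⟩
      · rw [Set.mem_ofPred_eq] at hw hw' ⊢
        rw [parity_mul, hw, hw']
      · simp
    | zero_left y hy => rw [zero_mul]; exact zero_mem _
    | zero_right x hx => rw [mul_zero]; exact zero_mem _
    | add_left x y z _ _ _ h1 h2 => rw [add_mul]; exact add_mem h1 h2
    | add_right x y z _ _ _ h1 h2 => rw [mul_add]; exact add_mem h1 h2
    | smul_left c x y _ _ h => rw [smul_mul_assoc]; exact Submodule.smul_mem _ c h
    | smul_right c x y _ _ h => rw [mul_smul_comm]; exact Submodule.smul_mem _ c h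

variable {F : Type u} [Field F]

/-- The free `V`-superalgebra on `r` even and `s` odd generators: the absolutely free
superalgebra modulo the smallest graded ideal whose quotient is a `V`-superalgebra. -/
noncomputable def free (V : Set (Alg F)) (r s : ℕ) : SuperAlg F :=
  (SuperIdeal.sInf {J : SuperIdeal (absFree F (Fin r) (Fin s)) |
    J.quotient ∈ superClass V}).quotient

end Free

section BasicSuperrank

variable {F : Type u} [Field F]

/-- `V_{r,s}`: the supervariety generated by the free `V`-superalgebra on `r` even and `s` odd
generators if `(r, s) ≠ (0, 0)`, and the class of zero superalgebras if `(r, s) = (0, 0)`. -/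
def level (V : Set (Alg F)) (p : ℕ × ℕ) : Set (SuperAlg F) :=
  if p = (0, 0) then {A | Subsingleton A.carrier}
  else supervarietyGenerated (free V p.1 p.2)

/-- `(r, s)` is a basic superrank of `V`: a minimal pair, for the componentwise order, with
`V_{r,s} = Ṽ`. -/
def IsBasicSuperrank (V : Set (Alg F)) (p : ℕ × ℕ) : Prop :=
  Minimal (fun q : ℕ × ℕ => level V q = superClass V) p

/-- The basic spectrum of `V`: the set of all its basic superranks. -/
def basicSpectrum (V : Set (Alg F)) : Set (ℕ × ℕ) :=
  {p | IsBasicSuperrank V p}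

end BasicSuperrank

end Superrank

/-! Write `𝔑` for the variety in question. The free `𝔑`-superalgebra on `r` even and `s` odd
generators is the free metabelian one itself (`free_varietyGenerated`), so the level of `(r, s)` is
everything. It remains to show that any pair `(r', s')` whose level is everything dominates `(r,
s)`; this gives both minimality and uniqueness.

The two sides are separated by the identities `hookPoly F K L`, in which the `L`-th power of a
standard polynomial in `K` left multiplications is applied to a product. In a metabelian algebra a
left multiplication acts on products only through the linear part of its argument, so in the
envelope every variable may be replaced by a Grassmann combination of generators. Expanding, each
cell of a `K × L` grid (variable, factor) chooses a generator. An even generator chosen by two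
variables in one factor gives zero by alternation; an odd generator chosen by one variable in two
factors gives zero because an odd Grassmann element generates an ideal of square zero. A nonzero
term therefore needs `K * L ≤ L * r' + K * s'`, so the identity holds when this fails
(`satisfies_hookPoly`).

Conversely, the identity fails for `(r, s)` as soon as `1 ≤ K ≤ r`, or `1 ≤ L ≤ s` with `K` positive
(`not_satisfies_of_even`, `not_satisfies_of_odd`): the free metabelian superalgebra maps to a path
algebra, where left multiplication by letters moves along a prescribed word and the value can be
computed. If `r' < r`, choose `K = r' + 1` and `L` large; if `s' < s`, choose `L = s' + 1` and `K`
large. Either choice is a contradiction. -/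

namespace Superrank

/-! ### Commutation rules and nonvanishing products in the Grassmann algebra. -/

section GrassmannFacts

variable {F : Type u} [Field F]

/-- The generators of the Grassmann algebra. -/
noncomputable def Grassmann.gen (F : Type u) [Field F] (i : ℕ) : Grassmann F :=
  ExteriorAlgebra.ι F (Finsupp.single i 1)

theorem Grassmann.gen_mem (i : ℕ) : Grassmann.gen F i ∈ Grassmann.part F 1 :=
  CliffordAlgebra.ι_mem_evenOdd_one _ _

theorem Grassmann.one_mem : (1 : Grassmann F) ∈ Grassmann.part F 0 :=
  SetLike.GradedOne.one_mem

/-- The sign rule; the grading involution carries the sign, so `h` need not be homogeneous. -/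
theorem Grassmann.ι_mul (v : ℕ →₀ F) (h : Grassmann F) :
    ExteriorAlgebra.ι F v * h = CliffordAlgebra.involute h * ExteriorAlgebra.ι F v := by
  induction h using CliffordAlgebra.induction with
  | algebraMap r => rw [AlgHom.commutes]; exact (Algebra.commutes _ _).symm
  | ι w =>
    rw [CliffordAlgebra.involute_ι, neg_mul]
    exact eq_neg_of_add_eq_zero_left (ExteriorAlgebra.ι_add_mul_swap v w)
  | mul a b ha hb => rw [map_mul, ← mul_assoc, ha, mul_assoc, hb, mul_assoc]
  | add a b ha hb => rw [map_add, mul_add, add_mul, ha, hb]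

theorem Grassmann.even_mul {g : Grassmann F} (hg : g ∈ Grassmann.part F 0) (h : Grassmann F) :
    g * h = h * g := by
  induction g, hg using CliffordAlgebra.even_induction with
  | algebraMap r => exact Algebra.commutes _ _
  | add x y _ _ hx hy => rw [add_mul, mul_add, hx, hy]
  | ι_mul_ι_mul v w x _ hx =>
    have hv := Grassmann.ι_mul v (CliffordAlgebra.involute h)
    rw [CliffordAlgebra.involute_involute] at hv
    calc _ = ExteriorAlgebra.ι F v * (ExteriorAlgebra.ι F w * h) * x := by
          rw [mul_assoc, hx, ← mul_assoc]; simp only [mul_assoc]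
      _ = h * (ExteriorAlgebra.ι F v * ExteriorAlgebra.ι F w * x) := by
          rw [Grassmann.ι_mul w h, ← mul_assoc, hv]; simp only [mul_assoc]
      _ = _ := rfl

theorem Grassmann.odd_mul {g : Grassmann F} (hg : g ∈ Grassmann.part F 1) (h : Grassmann F) :
    g * h = CliffordAlgebra.involute h * g := by
  induction g, hg using CliffordAlgebra.odd_induction with
  | ι v => exact Grassmann.ι_mul v h
  | add x y _ _ hx hy => rw [add_mul, mul_add, hx, hy]
  | ι_mul_ι_mul v w x _ hx =>
    have hv : ExteriorAlgebra.ι F v * ExteriorAlgebra.ι F w ∈ Grassmann.part F 0 :=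
      CliffordAlgebra.ι_mul_ι_mem_evenOdd_zero _ _ _
    have := Grassmann.even_mul hv (CliffordAlgebra.involute h)
    calc _ = (ExteriorAlgebra.ι F v * ExteriorAlgebra.ι F w) * (x * h) := mul_assoc _ _ _
      _ = (ExteriorAlgebra.ι F v * ExteriorAlgebra.ι F w * CliffordAlgebra.involute h) * x := by
          rw [hx, mul_assoc, mul_assoc, mul_assoc]
      _ = _ := by rw [this, mul_assoc]

/-- Moving `g` past `h` brings the two copies together, and `g * g` equals its own negative, hence
vanishes since 2 is invertible. -/
theorem Grassmann.odd_mul_mul_self [CharZero F] {g : Grassmann F} (hg : g ∈ Grassmann.part F 1)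
    (h : Grassmann F) : g * h * g = 0 := by
  have h1 : g * g = -(g * g) := by
    conv_lhs => rw [Grassmann.odd_mul hg g, CliffordAlgebra.involute_eq_of_mem_odd hg, neg_mul]
  have h2 : (2 : F) • (g * g) = 0 := by
    rw [two_smul]; nth_rewrite 1 [h1]; exact neg_add_cancel _
  rw [Grassmann.odd_mul hg, mul_assoc, (smul_eq_zero.1 h2).resolve_left two_ne_zero, mul_zero]

/-- Contraction with the coordinate dual to the leading generator strips that generator off and
annihilates the product of the others, so nonvanishing follows by induction. -/
theorem Grassmann.list_prod_ne_zero {l : List ℕ} (hl : l.Nodup) :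
    (l.map (Grassmann.gen F)).prod ≠ 0 := by
  have key : ∀ (i : ℕ) (l : List ℕ), i ∉ l →
      CliffordAlgebra.contractLeft (Q := (0 : QuadraticForm F (ℕ →₀ F)))
        (Finsupp.lapply i : (ℕ →₀ F) →ₗ[F] F)
        (l.map (Grassmann.gen F)).prod = 0 := by
    intro i l
    induction l with
    | nil => intro _; exact CliffordAlgebra.contractLeft_one (Q := (0 : QuadraticForm F (ℕ →₀ F))) _
    | cons j l ih =>
      intro hi
      rw [List.mem_cons, not_or] at hi
      rw [List.map_cons, List.prod_cons]
      refine (CliffordAlgebra.contractLeft_ι_mul (Q := (0 : QuadraticForm F (ℕ →₀ F))) _ _ _).trans ?_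
      rw [ih hi.2, mul_zero, sub_zero]
      simp [Finsupp.single_eq_of_ne hi.1]
  induction l with
  | nil => exact one_ne_zero
  | cons j l ih =>
    rw [List.nodup_cons] at hl
    intro h0
    rw [List.map_cons, List.prod_cons] at h0
    apply ih hl.2
    have := CliffordAlgebra.contractLeft_ι_mul (Q := (0 : QuadraticForm F (ℕ →₀ F)))
      (Finsupp.lapply j : (ℕ →₀ F) →ₗ[F] F)
      (Finsupp.single j 1) (l.map (Grassmann.gen F)).prod
    rw [key j l hl.1, mul_zero, sub_zero] at this
    simp only [Finsupp.lapply_apply, Finsupp.single_eq_same, one_smul] at this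
    rw [← this]
    exact (congrArg _ h0).trans (map_zero _)

end GrassmannFacts

/-! ### The standard polynomial as an alternating map. -/

section StandardPolynomial

variable (F : Type u) [Field F] {R S : Type*} [Ring R] [Algebra F R] [Ring S] [Algebra F S]

/-- The standard polynomial `∑ sgn(σ) x_{σ(1)} ⋯ x_{σ(n)}`, as an alternating map. -/
noncomputable def standardPoly (R : Type*) [Ring R] [Algebra F R] (n : ℕ) : R [⋀^Fin n]→ₗ[F] R :=
  MultilinearMap.alternatization (MultilinearMap.mkPiAlgebraFin F n R)

variable {F}

theorem standardPoly_apply {n : ℕ} (x : Fin n → R) :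
    standardPoly F R n x =
      ∑ σ : Equiv.Perm (Fin n), Equiv.Perm.sign σ • (List.ofFn fun i => x (σ i)).prod := by
  rw [standardPoly, MultilinearMap.alternatization_apply]
  rfl

theorem map_standardPoly (φ : R →ₐ[F] S) {n : ℕ} (x : Fin n → R) :
    φ (standardPoly F R n x) = standardPoly F S n (fun i => φ (x i)) := by
  simp only [standardPoly_apply, map_sum, Units.smul_def, map_zsmul, map_list_prod, List.map_ofFn]
  rfl

theorem prod_ofFn_update_mul {n : ℕ} {a : R} (z : Fin n → R) (p : Fin n) (w : R)
    (ha : ∀ k, k ≠ p → Commute a (z k)) :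
    (List.ofFn (Function.update z p (a * w))).prod =
      a * (List.ofFn (Function.update z p w)).prod := by
  induction n with
  | zero => exact p.elim0
  | succ n ih =>
    rw [List.ofFn_succ, List.ofFn_succ, List.prod_cons, List.prod_cons]
    cases p using Fin.cases with
    | zero => simp [mul_assoc]
    | succ p =>
      have h := ih (fun i => z i.succ) p fun k hk => ha k.succ (by simpa using hk)
      have e : ∀ v, (fun i : Fin n => Function.update z p.succ v i.succ) =
          Function.update (fun i => z i.succ) p v := fun v => by
        ext i
        simp [Function.update_apply]
      rw [e, e, h, Function.update_of_ne (Fin.succ_ne_zero p).symm,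
        Function.update_of_ne (Fin.succ_ne_zero p).symm, ← mul_assoc, ← mul_assoc,
        (ha 0 (Fin.succ_ne_zero p).symm).eq]

theorem standardPoly_update_mul {n : ℕ} {a : R} (z : Fin n → R) (p : Fin n) (w : R)
    (ha : ∀ k, k ≠ p → Commute a (z k)) :
    standardPoly F R n (Function.update z p (a * w)) =
      a * standardPoly F R n (Function.update z p w) := by
  rw [standardPoly_apply, standardPoly_apply, Finset.mul_sum]
  refine Finset.sum_congr rfl fun σ _ => ?_
  have e : ∀ v, (fun i => Function.update z p v (σ i)) =
      Function.update (fun i => z (σ i)) (σ.symm p) v := fun v => by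
    ext i
    simp only [Function.update_apply, Equiv.eq_symm_apply]
  rw [e, e, prod_ofFn_update_mul, mul_smul_comm]
  exact fun k hk => ha _ fun h => hk (by rw [← h, Equiv.symm_apply_apply])

/-- Once the central coefficients are pulled out, the arguments at `p` and `q` are both `w`, and
alternation applies. -/
theorem standardPoly_eq_zero_of_commute {n : ℕ} (z : Fin n → R) {p q : Fin n} (hpq : p ≠ q)
    {a b w : R} (ha : ∀ t, Commute a t) (hb : ∀ t, Commute b t) (hp : z p = a * w)
    (hq : z q = b * w) : standardPoly F R n z = 0 := by
  rw [← Function.update_eq_self p z, hp, standardPoly_update_mul _ _ _ fun _ _ => ha _,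
    ← Function.update_eq_self q (Function.update z p w), Function.update_of_ne hpq.symm, hq,
    standardPoly_update_mul _ _ _ fun _ _ => hb _,
    AlternatingMap.map_eq_zero_of_eq _ _ (i := p) (j := q) _ hpq, mul_zero, mul_zero]
  rw [Function.update_of_ne hpq, Function.update_self, Function.update_self]

end StandardPolynomial

/-! ### Vanishing of powers of the standard polynomial by counting. -/

section Pigeonhole

variable {F : Type u} [Field F] {R : Type*} [Ring R] [Algebra F R]

/-- The two-sided ideal generated by an element, as a subspace. -/
def idealSpan (F : Type u) [Field F] {R : Type*} [Ring R] [Algebra F R] (g : R) : Submodule F R :=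
  Submodule.span F {t | ∃ a b, t = a * g * b}

theorem mul_mem_idealSpan_left {g t : R} (a : R) (ht : t ∈ idealSpan F g) :
    a * t ∈ idealSpan F g := by
  induction ht using Submodule.span_induction with
  | mem t h =>
    obtain ⟨b, c, rfl⟩ := h
    exact Submodule.subset_span ⟨a * b, c, by simp only [mul_assoc]⟩
  | zero => rw [mul_zero]; exact zero_mem _
  | add x y _ _ hx hy => rw [mul_add]; exact add_mem hx hy
  | smul c x _ hx => rw [mul_smul_comm]; exact Submodule.smul_mem _ c hx

theorem mul_mem_idealSpan_right {g t : R} (a : R) (ht : t ∈ idealSpan F g) :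
    t * a ∈ idealSpan F g := by
  induction ht using Submodule.span_induction with
  | mem t h =>
    obtain ⟨b, c, rfl⟩ := h
    exact Submodule.subset_span ⟨b, c * a, by simp only [mul_assoc]⟩
  | zero => rw [zero_mul]; exact zero_mem _
  | add x y _ _ hx hy => rw [add_mul]; exact add_mem hx hy
  | smul c x _ hx => rw [smul_mul_assoc]; exact Submodule.smul_mem _ c hx

/-- The hypothesis on `g` says exactly that the two-sided ideal it generates has square zero. -/
theorem mul_eq_zero_of_mem_idealSpan {g : R} (hg : ∀ t, g * t * g = 0) {s t : R}
    (hs : s ∈ idealSpan F g) (ht : t ∈ idealSpan F g) : s * t = 0 := by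
  induction hs, ht using Submodule.span_induction₂ with
  | mem_mem s t hs ht =>
    obtain ⟨a, b, rfl⟩ := hs
    obtain ⟨c, d, rfl⟩ := ht
    calc a * g * b * (c * g * d) = a * (g * (b * c) * g) * d := by simp only [mul_assoc]
      _ = 0 := by rw [hg, mul_zero, zero_mul]
  | zero_left => rw [zero_mul]
  | zero_right => rw [mul_zero]
  | add_left x y z _ _ _ h1 h2 => rw [add_mul, h1, h2, add_zero]
  | add_right x y z _ _ _ h1 h2 => rw [mul_add, h1, h2, add_zero]
  | smul_left c x y _ _ h => rw [smul_mul_assoc, h, smul_zero]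
  | smul_right c x y _ _ h => rw [mul_smul_comm, h, smul_zero]

theorem list_prod_mem_idealSpan {g : R} {l : List R} {t : R} (ht : t ∈ l)
    (hg : t ∈ idealSpan F g) : l.prod ∈ idealSpan F g := by
  induction l with
  | nil => simp at ht
  | cons a l ih =>
    rw [List.prod_cons]
    rcases List.mem_cons.1 ht with rfl | h
    · exact mul_mem_idealSpan_right _ hg
    · exact mul_mem_idealSpan_left _ (ih h)

theorem prod_ofFn_eq_zero_of_mem_idealSpan {g : R} (hg : ∀ t, g * t * g = 0) {n : ℕ}
    (x : Fin n → R) {i j : Fin n} (hij : i < j) (hi : x i ∈ idealSpan F g)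
    (hj : x j ∈ idealSpan F g) : (List.ofFn x).prod = 0 := by
  induction n with
  | zero => exact i.elim0
  | succ n ih =>
    rw [List.ofFn_succ, List.prod_cons]
    cases j using Fin.cases with
    | zero => exact absurd hij (Fin.not_lt_zero i)
    | succ j =>
      cases i using Fin.cases with
      | zero =>
        exact mul_eq_zero_of_mem_idealSpan hg hi
          (list_prod_mem_idealSpan (List.mem_ofFn.2 ⟨j, rfl⟩) hj)
      | succ i => rw [ih (fun k => x k.succ) (Fin.succ_lt_succ_iff.1 hij) hi hj, mul_zero]

theorem standardPoly_mem_idealSpan {g : R} {n : ℕ} (x : Fin n → R) (i : Fin n)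
    (hi : x i ∈ idealSpan F g) : standardPoly F R n x ∈ idealSpan F g := by
  rw [standardPoly_apply]
  refine Submodule.sum_mem _ fun σ _ => ?_
  have h : (List.ofFn fun i => x (σ i)).prod ∈ idealSpan F g :=
    list_prod_mem_idealSpan (List.mem_ofFn.2 ⟨σ.symm i, by simp⟩) hi
  rw [Units.smul_def]
  exact zsmul_mem h _

/-- A power of the standard polynomial vanishes on Grassmann combinations of few even and few
odd elements. -/
theorem standardPoly_pow_eq_zero [CharZero F] {E : Type*} [Ring E] [Algebra F E]
    {r s K L : ℕ} (hKL : L * r + K * s < K * L) (g : Fin K → Fin r ⊕ Fin s → Grassmann F)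
    (h0 : ∀ i c, g i (.inl c) ∈ Grassmann.part F 0)
    (h1 : ∀ i c, g i (.inr c) ∈ Grassmann.part F 1) (e : Fin r ⊕ Fin s → E) :
    standardPoly F (Grassmann F ⊗[F] E) K (fun i => ∑ c, g i c ⊗ₜ[F] e c) ^ L = 0 := by
  classical
  rw [← MultilinearMap.mkPiAlgebraFin_apply_const (R := F)]
  have hS : standardPoly F (Grassmann F ⊗[F] E) K (fun i => ∑ c, g i c ⊗ₜ[F] e c) =
      ∑ d : Fin K → Fin r ⊕ Fin s, standardPoly F (Grassmann F ⊗[F] E) K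
        (fun i => g i (d i) ⊗ₜ[F] e (d i)) :=
    (standardPoly F (Grassmann F ⊗[F] E) K).toMultilinearMap.map_sum
      (fun i c => g i c ⊗ₜ[F] e c)
  rw [hS, MultilinearMap.map_sum]
  -- Multilinearity has expanded everything; `D j i` is the generator chosen by variable `i` in the
  -- `j`-th factor. Each term is shown to vanish.
  refine Finset.sum_eq_zero fun D _ => ?_
  have hsplit : ∀ i c, g i c ⊗ₜ[F] e c = (g i c ⊗ₜ[F] (1 : E)) * ((1 : Grassmann F) ⊗ₜ[F] e c) :=
    fun i c => by rw [Algebra.TensorProduct.tmul_mul_tmul, mul_one, one_mul]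
  -- Two variables choose the same even generator in one factor: their coefficients are central, so
  -- that factor vanishes by alternation.
  by_cases hE : ∃ j i i' c, i ≠ i' ∧ D j i = .inl c ∧ D j i' = .inl c
  · obtain ⟨j, i, i', c, hii, hi, hi'⟩ := hE
    have hcomm : ∀ i (t : Grassmann F ⊗[F] E), Commute (g i (.inl c) ⊗ₜ[F] (1 : E)) t := by
      intro i t
      induction t with
      | zero => exact Commute.zero_right _
      | add x y hx hy => exact hx.add_right hy
      | tmul h b =>
        rw [Commute, SemiconjBy, Algebra.TensorProduct.tmul_mul_tmul,
          Algebra.TensorProduct.tmul_mul_tmul, one_mul, mul_one, Grassmann.even_mul (h0 i c)]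
    refine MultilinearMap.map_coord_zero _ j ?_
    refine standardPoly_eq_zero_of_commute _ hii (hcomm i) (hcomm i')
      (w := (1 : Grassmann F) ⊗ₜ[F] e (.inl c)) ?_ ?_
    · rw [hi, hsplit]
    · rw [hi', hsplit]
  -- One variable chooses the same odd generator in two factors: both factors lie in the square-zero
  -- ideal of the same odd coefficient.
  by_cases hO : ∃ i j j' c, j < j' ∧ D j i = .inr c ∧ D j' i = .inr c
  · obtain ⟨i, j, j', c, hjj, hj, hj'⟩ := hO
    rw [MultilinearMap.mkPiAlgebraFin_apply]
    have hg : ∀ t : Grassmann F ⊗[F] E,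
        (g i (.inr c) ⊗ₜ[F] (1 : E)) * t * (g i (.inr c) ⊗ₜ[F] (1 : E)) = 0 := by
      intro t
      induction t with
      | zero => rw [mul_zero, zero_mul]
      | add x y hx hy => rw [mul_add, add_mul, hx, hy, add_zero]
      | tmul h b =>
        rw [Algebra.TensorProduct.tmul_mul_tmul, Algebra.TensorProduct.tmul_mul_tmul,
          Grassmann.odd_mul_mul_self (h1 i c), TensorProduct.zero_tmul]
    have hmem : ∀ j, D j i = .inr c → standardPoly F (Grassmann F ⊗[F] E) K
        (fun i => g i (D j i) ⊗ₜ[F] e (D j i)) ∈ idealSpan F (g i (.inr c) ⊗ₜ[F] (1 : E)) := by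
      intro j hj
      refine standardPoly_mem_idealSpan _ i (Submodule.subset_span ⟨1, 1 ⊗ₜ[F] e (.inr c), ?_⟩)
      rw [hj, one_mul, hsplit]
    exact prod_ofFn_eq_zero_of_mem_idealSpan (F := F) hg _ hjj (hmem j hj) (hmem j' hj')
  exfalso
  push Not at hE hO
  -- Otherwise a cell is determined by its factor and its even generator, or by its variable and its
  -- odd generator, which forces `K * L ≤ L * r + K * s`.
  let f : Fin K × Fin L → (Fin L × Fin r) ⊕ (Fin K × Fin s) := fun p =>
    (D p.2 p.1).map (fun c => (p.2, c)) (fun c => (p.1, c))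
  have hf : Function.Injective f := by
    rintro ⟨i, j⟩ ⟨i', j'⟩ h
    simp only [f] at h
    rcases hc : D j i with c | c <;> rcases hc' : D j' i' with c' | c' <;>
      simp only [hc, hc', Sum.map_inl, Sum.map_inr, Sum.inl.injEq, Sum.inr.injEq, Prod.mk.injEq,
        reduceCtorEq] at h
    · obtain ⟨rfl, rfl⟩ := h
      by_contra hne
      exact hE j i i' c (fun h => hne (by rw [h])) hc hc'
    · obtain ⟨rfl, rfl⟩ := h
      rcases lt_trichotomy j j' with hlt | rfl | hlt
      · exact absurd hc' (hO i j j' c hlt hc)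
      · rfl
      · exact absurd hc (hO i j' j c hlt hc')
  have := Fintype.card_le_of_injective f hf
  simp only [Fintype.card_prod, Fintype.card_sum, Fintype.card_fin] at this
  omega

end Pigeonhole

/-! ### The separating identities and their evaluation. -/

section OperatorIdentity

variable {F : Type u} [Field F]

/-- The pairs of endomorphisms preserving a linear relation. -/
def relSubalgebra {A B : Type*} [AddCommGroup A] [Module F A] [AddCommGroup B] [Module F B]
    (Γ : Submodule F (A × B)) : Subalgebra F (Module.End F A × Module.End F B) where
  carrier := {T | ∀ q ∈ Γ, (T.1 q.1, T.2 q.2) ∈ Γ}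
  mul_mem' hS hT q hq := hS _ (hT q hq)
  add_mem' hS hT q hq := Γ.add_mem (hS q hq) (hT q hq)
  algebraMap_mem' c _ hq := Γ.smul_mem c hq

/-- The polynomial is evaluated inside the algebra of pairs and projected to both factors. With `Γ`
a graph this pushes operators through a homomorphism that induces no map of endomorphism algebras;
with `Γ` a diagonal it compares operators that agree on an invariant subspace. -/
theorem standardPoly_pow_mem_relSubalgebra {A B : Type*} [AddCommGroup A] [Module F A]
    [AddCommGroup B] [Module F B] (Γ : Submodule F (A × B)) {K : ℕ} (L : ℕ)
    {x : Fin K → Module.End F A} {y : Fin K → Module.End F B}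
    (h : ∀ i, (x i, y i) ∈ relSubalgebra Γ) :
    (standardPoly F _ K x ^ L, standardPoly F _ K y ^ L) ∈ relSubalgebra Γ := by
  let z : Fin K → relSubalgebra Γ := fun i => ⟨(x i, y i), h i⟩
  have h1 := map_standardPoly ((AlgHom.fst F _ _).comp (relSubalgebra Γ).val) z
  have h2 := map_standardPoly ((AlgHom.snd F _ _).comp (relSubalgebra Γ).val) z
  have h3 : (standardPoly F _ K x ^ L, standardPoly F _ K y ^ L) =
      ((standardPoly F _ K z ^ L : relSubalgebra Γ) : Module.End F A × Module.End F B) := by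
    rw [SubmonoidClass.coe_pow]
    exact Prod.ext (congrArg (· ^ L) h1.symm) (congrArg (· ^ L) h2.symm)
  rw [h3]
  exact SetLike.coe_mem _

/-- The polynomial `S_K(L_{x₂}, …, L_{x_{K+1}})^L (x₀ x₁)`, where `S_K` is the standard
polynomial and `L_x` is the left multiplication by `x`. -/
noncomputable def hookPoly (F : Type u) [Field F] (K L : ℕ) : FreeNonUnitalNonAssocAlgebra F ℕ :=
  (standardPoly F (Module.End F (FreeNonUnitalNonAssocAlgebra F ℕ)) K
    (fun i => LinearMap.mulLeft F (FreeNonUnitalNonAssocAlgebra.of F ((i : ℕ) + 2))) ^ L)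
    (FreeNonUnitalNonAssocAlgebra.of F 0 * FreeNonUnitalNonAssocAlgebra.of F 1)

theorem lift_hookPoly {A : Type*} [NonUnitalNonAssocRing A] [Module F A] [IsScalarTower F A A]
    [SMulCommClass F A A] (v : ℕ → A) (K L : ℕ) :
    FreeNonUnitalNonAssocAlgebra.lift F v (hookPoly F K L) =
      (standardPoly F (Module.End F A) K (fun i => LinearMap.mulLeft F (v ((i : ℕ) + 2))) ^ L)
        (v 0 * v 1) := by
  let φ := FreeNonUnitalNonAssocAlgebra.lift F v
  let φ' : FreeNonUnitalNonAssocAlgebra F ℕ →ₗ[F] A := φ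
  -- Multiplicativity of `φ` means that left multiplications by an element and by its image together
  -- preserve the graph.
  have h := standardPoly_pow_mem_relSubalgebra (LinearMap.graph φ') (K := K) L
    (x := fun i => LinearMap.mulLeft F (FreeNonUnitalNonAssocAlgebra.of F ((i : ℕ) + 2)))
    (y := fun i => LinearMap.mulLeft F (v ((i : ℕ) + 2))) ?_
    (FreeNonUnitalNonAssocAlgebra.of F 0 * FreeNonUnitalNonAssocAlgebra.of F 1, v 0 * v 1) ?_
  · exact ((LinearMap.mem_graph_iff φ' _).1 h).symm
  · rintro i ⟨a, b⟩ hq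
    rw [LinearMap.mem_graph_iff] at hq ⊢
    have hq' : b = φ a := hq
    change v (i + 2) * b = φ (_ * a)
    rw [map_mul, hq', FreeNonUnitalNonAssocAlgebra.lift_of_apply]
  · rw [LinearMap.mem_graph_iff]
    change v 0 * v 1 = φ (_ * _)
    rw [map_mul, FreeNonUnitalNonAssocAlgebra.lift_of_apply,
      FreeNonUnitalNonAssocAlgebra.lift_of_apply]

theorem map_lift {X A B : Type*} [NonUnitalNonAssocRing A] [Module F A] [IsScalarTower F A A]
    [SMulCommClass F A A] [NonUnitalNonAssocRing B] [Module F B] [IsScalarTower F B B]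
    [SMulCommClass F B B] (φ : A →ₙₐ[F] B) (v : X → A) (f : FreeNonUnitalNonAssocAlgebra F X) :
    φ (FreeNonUnitalNonAssocAlgebra.lift F v f) =
      FreeNonUnitalNonAssocAlgebra.lift F (fun n => φ (v n)) f := by
  have h : φ.comp (FreeNonUnitalNonAssocAlgebra.lift F v) =
      FreeNonUnitalNonAssocAlgebra.lift F (fun n => φ (v n)) := by
    refine FreeNonUnitalNonAssocAlgebra.hom_ext F fun n => ?_
    rw [NonUnitalAlgHom.comp_apply, FreeNonUnitalNonAssocAlgebra.lift_of_apply,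
      FreeNonUnitalNonAssocAlgebra.lift_of_apply]
  exact DFunLike.congr_fun h f

theorem SuperAlg.envelope_satisfies_iff (A : SuperAlg F) (f : FreeNonUnitalNonAssocAlgebra F ℕ) :
    A.envelope.Satisfies f ↔ ∀ v : ℕ → Grassmann F ⊗[F] A.carrier,
      (∀ n, v n ∈ A.envelopeSubmodule) → FreeNonUnitalNonAssocAlgebra.lift F v f = 0 := by
  let ψ : A.envelope.carrier →ₙₐ[F] Grassmann F ⊗[F] A.carrier :=
    NonUnitalSubalgebraClass.subtype A.envelopeSubalgebra
  have hψ : Function.Injective ψ := Subtype.val_injective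
  constructor
  · intro h v hv
    have h1 := map_lift ψ (fun n => (⟨v n, hv n⟩ : A.envelopeSubalgebra)) f
    have h2 : FreeNonUnitalNonAssocAlgebra.lift F
      (fun n => (⟨v n, hv n⟩ : A.envelopeSubalgebra)) f = 0 := h _
    exact h1.symm.trans ((congrArg ψ h2).trans (map_zero ψ))
  · intro h v
    refine hψ ?_
    rw [map_lift ψ v f, map_zero]
    exact h _ fun n => (v n).2

theorem SuperAlg.tmul_mem_envelope (A : SuperAlg F) {i : ZMod 2} {g : Grassmann F}
    {a : A.carrier} (hg : g ∈ Grassmann.part F i) (ha : a ∈ A.part i) :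
    g ⊗ₜ[F] a ∈ A.envelopeSubmodule :=
  Submodule.mem_iSup_of_mem i (Submodule.apply_mem_map₂ _ hg ha)

/-- The extension of scalars of a homomorphism to the Grassmann algebra. -/
noncomputable def tensorMap {A B : Type*} [NonUnitalNonAssocRing A] [Module F A]
    [IsScalarTower F A A] [SMulCommClass F A A] [NonUnitalNonAssocRing B] [Module F B]
    [IsScalarTower F B B] [SMulCommClass F B B] (φ : A →ₙₐ[F] B) :
    Grassmann F ⊗[F] A →ₙₐ[F] Grassmann F ⊗[F] B :=
  { LinearMap.lTensor (Grassmann F) (φ : A →ₗ[F] B) with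
    map_zero' := map_zero _
    map_mul' := fun x y => by
      change LinearMap.lTensor (Grassmann F) (φ : A →ₗ[F] B) (x * y) =
        LinearMap.lTensor (Grassmann F) (φ : A →ₗ[F] B) x *
          LinearMap.lTensor (Grassmann F) (φ : A →ₗ[F] B) y
      induction x with
      | zero => rw [zero_mul, map_zero, zero_mul]
      | add x x' hx hx' => rw [add_mul, map_add, hx, hx', map_add, add_mul]
      | tmul g a =>
        induction y with
        | zero => rw [mul_zero, map_zero, mul_zero]
        | add x x' hx hx' => rw [mul_add, map_add, hx, hx', map_add, mul_add]
        | tmul h b => simp }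

theorem tensorMap_tmul {A B : Type*} [NonUnitalNonAssocRing A] [Module F A]
    [IsScalarTower F A A] [SMulCommClass F A A] [NonUnitalNonAssocRing B] [Module F B]
    [IsScalarTower F B B] [SMulCommClass F B B] (φ : A →ₙₐ[F] B) (g : Grassmann F) (a : A) :
    tensorMap φ (g ⊗ₜ[F] a) = g ⊗ₜ[F] φ a := rfl

end OperatorIdentity

/-! ### Metabelian superalgebras and the identities of their envelopes. -/

section Metabelian

variable {F : Type u} [Field F]

theorem tensor_metabelian {B : Type*} [NonUnitalNonAssocRing B] [Module F B]
    [IsScalarTower F B B] [SMulCommClass F B B] (h : ∀ a b c d : B, (a * b) * (c * d) = 0)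
    (x y z t : Grassmann F ⊗[F] B) : (x * y) * (z * t) = 0 := by
  induction x with
  | zero => simp only [zero_mul]
  | add x x' hx hx' => simp only [add_mul, hx, hx', add_zero]
  | tmul g a =>
  induction y with
  | zero => simp only [mul_zero, zero_mul]
  | add x x' hx hx' => simp only [mul_add, add_mul, hx, hx', add_zero]
  | tmul g' b =>
  induction z with
  | zero => simp only [mul_zero, zero_mul]
  | add x x' hx hx' => simp only [mul_add, add_mul, hx, hx', add_zero]
  | tmul k c =>
  induction t with
  | zero => simp only [mul_zero]
  | add x x' hx hx' => simp only [mul_add, hx, hx', add_zero]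
  | tmul k' d => simp only [Algebra.TensorProduct.tmul_mul_tmul, h, TensorProduct.tmul_zero]

theorem envelope_mem_metabelian {B : SuperAlg F}
    (h : ∀ a b c d : B.carrier, (a * b) * (c * d) = 0) : B.envelope ∈ metabelian F :=
  fun x y z t => Subtype.ext (tensor_metabelian h x.1 y.1 z.1 t.1)

theorem tmul_ne_zero {B : Type*} [AddCommGroup B] [Module F B] {g : Grassmann F} {b : B}
    (hg : g ≠ 0) (hb : b ≠ 0) : g ⊗ₜ[F] b ≠ 0 := by
  obtain ⟨φ, hφ⟩ : ∃ φ : Module.Dual F B, φ b ≠ 0 := by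
    by_contra! h
    exact hb ((Module.forall_dual_apply_eq_zero_iff F b).1 h)
  intro h
  have h1 := congrArg (TensorProduct.rid F _ ∘ LinearMap.lTensor (Grassmann F) φ) h
  simp only [Function.comp_apply, LinearMap.lTensor_tmul, TensorProduct.rid_tmul, map_zero] at h1
  exact (smul_ne_zero hφ hg) h1

/-- By linearity the four elements may be taken homogeneous. Even ones are paired with 1 and odd
ones with distinct Grassmann generators, so the Grassmann factor of the product is nonzero. -/
theorem metabelian_of_envelope {B : SuperAlg F} (h : B.envelope ∈ metabelian F)
    (a b c d : B.carrier) : (a * b) * (c * d) = 0 := by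
  have hdec : ∀ a : B.carrier, ∃ f : ZMod 2 → B.carrier, (∀ i, f i ∈ B.part i) ∧
      a = ∑ i, f i := by
    intro a
    have ha : a ∈ B.part 0 ⊔ B.part 1 := by rw [B.isCompl.sup_eq_top]; trivial
    obtain ⟨x, hx, y, hy, rfl⟩ := Submodule.mem_sup.1 ha
    refine ⟨![x, y], fun i => ?_, (Fin.sum_univ_two ![x, y]).symm⟩
    fin_cases i
    · exact hx
    · exact hy
  let w : ℕ → ZMod 2 → List ℕ := fun n i => if i = 0 then [] else [n]
  have hw : ∀ n i, ((w n i).map (Grassmann.gen F)).prod ∈ Grassmann.part F i := by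
    intro n i
    have hi : i = 0 ∨ i = 1 := by revert i; decide
    rcases hi with rfl | rfl
    · exact Grassmann.one_mem
    · simpa [w] using Grassmann.gen_mem n
  obtain ⟨a, ha, rfl⟩ := hdec a
  obtain ⟨b, hb, rfl⟩ := hdec b
  obtain ⟨c, hc, rfl⟩ := hdec c
  obtain ⟨d, hd, rfl⟩ := hdec d
  have key : ∀ i j k l, (a i * b j) * (c k * d l) = 0 := by
    intro i j k l
    have h1 := congrArg Subtype.val (h
      (⟨_, B.tmul_mem_envelope (hw 0 i) (ha i)⟩ : B.envelopeSubalgebra)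
      (⟨_, B.tmul_mem_envelope (hw 1 j) (hb j)⟩ : B.envelopeSubalgebra)
      (⟨_, B.tmul_mem_envelope (hw 2 k) (hc k)⟩ : B.envelopeSubalgebra)
      (⟨_, B.tmul_mem_envelope (hw 3 l) (hd l)⟩ : B.envelopeSubalgebra))
    have h2 : (((w 0 i ++ w 1 j) ++ (w 2 k ++ w 3 l)).map (Grassmann.gen F)).prod ⊗ₜ[F]
        ((a i * b j) * (c k * d l)) = 0 := by
      simp only [List.map_append, List.prod_append, ← Algebra.TensorProduct.tmul_mul_tmul]
      exact h1
    by_contra h3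
    refine tmul_ne_zero (Grassmann.list_prod_ne_zero ?_) h3 h2
    simp only [w]
    split_ifs <;> decide
  simp only [Finset.sum_mul, Finset.mul_sum, key, Finset.sum_const_zero]

/-- The parity of a generator. -/
def genParity {X Y : Type} : X ⊕ Y → ZMod 2 := Sum.elim (fun _ => 0) (fun _ => 1)

/-- The span of all products of two elements. -/
def squareSpan (F : Type u) [Field F] (B : Type*) [NonUnitalNonAssocRing B] [Module F B] :
    Submodule F B := Submodule.span F {x | ∃ a b, x = a * b}

/-- The homogeneous parts are spanned by generators modulo products, and products annihilate
products, so only the linear part of `x` acts on `y * z`. -/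
theorem exists_decomposition {B : SuperAlg F}
    (hB : ∀ a b c d : B.carrier, (a * b) * (c * d) = 0) {r s : ℕ} (e : Fin r ⊕ Fin s → B.carrier)
    (he : ∀ i, B.part i ≤
      Submodule.span F (e '' {c | genParity c = i}) ⊔ squareSpan F B.carrier)
    {x : Grassmann F ⊗[F] B.carrier} (hx : x ∈ B.envelopeSubmodule) :
    ∃ g : Fin r ⊕ Fin s → Grassmann F, (∀ c, g c ∈ Grassmann.part F (genParity c)) ∧
      ∀ y z, x * (y * z) = (∑ c, g c ⊗ₜ[F] e c) * (y * z) := by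
  classical
  let T : Submodule F (Grassmann F ⊗[F] B.carrier) :=
    { carrier := {x | ∃ g : Fin r ⊕ Fin s → Grassmann F,
        (∀ c, g c ∈ Grassmann.part F (genParity c)) ∧
          ∀ y z, x * (y * z) = (∑ c, g c ⊗ₜ[F] e c) * (y * z)}
      zero_mem' := ⟨0, fun c => zero_mem _, fun y z => by simp⟩
      add_mem' := by
        rintro x x' ⟨g, hg, h⟩ ⟨g', hg', h'⟩
        refine ⟨g + g', fun c => add_mem (hg c) (hg' c), fun y z => ?_⟩
        rw [add_mul, h, h', ← add_mul, ← Finset.sum_add_distrib]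
        simp only [Pi.add_apply, TensorProduct.add_tmul]
      smul_mem' := by
        rintro k x ⟨g, hg, h⟩
        refine ⟨k • g, fun c => Submodule.smul_mem _ k (hg c), fun y z => ?_⟩
        rw [smul_mul_assoc, h, ← smul_mul_assoc, Finset.smul_sum]
        simp only [Pi.smul_apply, TensorProduct.smul_tmul'] }
  suffices h : B.envelopeSubmodule ≤ T from h hx
  refine iSup_le fun i => Submodule.map₂_le.2 fun g hg b hb => ?_
  suffices h : Submodule.span F (e '' {c | genParity c = i}) ⊔ squareSpan F B.carrier ≤
      T.comap (TensorProduct.mk F _ _ g) from h (he i hb)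
  refine sup_le (Submodule.span_le.2 ?_) (Submodule.span_le.2 ?_)
  · rintro _ ⟨c, hc, rfl⟩
    refine ⟨Pi.single c g, fun c' => ?_, fun y z => ?_⟩
    · by_cases h : c' = c
      · subst h
        have hc' : genParity c' = i := hc
        rw [Pi.single_eq_same, hc']
        exact hg
      · rw [Pi.single_eq_of_ne h]
        exact zero_mem _
    · rw [Finset.sum_eq_single c, Pi.single_eq_same]
      · rfl
      · intro c' _ h
        rw [Pi.single_eq_of_ne h, TensorProduct.zero_tmul]
      · exact fun h => absurd (Finset.mem_univ c) h
  · rintro _ ⟨a, b, rfl⟩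
    refine ⟨0, fun c => zero_mem _, fun y z => ?_⟩
    -- The factors may lie outside the envelope, which is harmless: the metabelian identity holds on
    -- all of the tensor product.
    have h1 : g ⊗ₜ[F] (a * b) = (g ⊗ₜ[F] a) * ((1 : Grassmann F) ⊗ₜ[F] b) := by
      rw [Algebra.TensorProduct.tmul_mul_tmul, mul_one]
    simp only [Pi.zero_apply, TensorProduct.zero_tmul, Finset.sum_const_zero, zero_mul,
      TensorProduct.mk_apply]
    rw [h1, tensor_metabelian hB]

/-- The action of `G ⊗ End B` on `G ⊗ B`. -/
noncomputable def tensorEnd (F : Type u) [Field F] (B : Type u) [AddCommGroup B] [Module F B] :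
    Grassmann F ⊗[F] Module.End F B →ₐ[F] Module.End F (Grassmann F ⊗[F] B) :=
  (Module.endTensorEndAlgHom (R := F) (S := F) (A := F)).comp
    (Algebra.TensorProduct.map (Algebra.lmul F (Grassmann F)) (AlgHom.id F (Module.End F B)))

theorem tensorEnd_mulLeft {B : Type u} [NonUnitalNonAssocRing B] [Module F B]
    [IsScalarTower F B B] [SMulCommClass F B B] (g : Grassmann F) (b : B) :
    tensorEnd F B (g ⊗ₜ[F] LinearMap.mulLeft F b) = LinearMap.mulLeft F (g ⊗ₜ[F] b) := by
  refine TensorProduct.ext' fun h c => ?_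
  simp only [tensorEnd, AlgHom.comp_apply, Algebra.TensorProduct.map_tmul]
  erw [Module.endTensorEndAlgHom_apply, TensorProduct.AlgebraTensorModule.map_tmul]
  rw [LinearMap.mulLeft_apply, Algebra.TensorProduct.tmul_mul_tmul]
  rfl

/-- The Grassmann envelope of a metabelian superalgebra with few generators satisfies
`hookPoly`. -/
theorem satisfies_hookPoly [CharZero F] {B : SuperAlg F}
    (hB : ∀ a b c d : B.carrier, (a * b) * (c * d) = 0) {r s K L : ℕ}
    (hKL : L * r + K * s < K * L) (e : Fin r ⊕ Fin s → B.carrier)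
    (he : ∀ i, B.part i ≤
      Submodule.span F (e '' {c | genParity c = i}) ⊔ squareSpan F B.carrier) :
    B.envelope.Satisfies (hookPoly F K L) := by
  rw [SuperAlg.envelope_satisfies_iff]
  intro v hv
  choose g hg hgv using fun n => exists_decomposition hB e he (hv n)
  rw [lift_hookPoly]
  let M := squareSpan F (Grassmann F ⊗[F] B.carrier)
  -- The diagonal of `M`: a pair of operators preserves it exactly when both agree on `M` and map
  -- `M` into itself.
  let Γ : Submodule F ((Grassmann F ⊗[F] B.carrier) × (Grassmann F ⊗[F] B.carrier)) :=
    M.map (LinearMap.prod LinearMap.id LinearMap.id)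
  have h := standardPoly_pow_mem_relSubalgebra Γ (K := K) L
    (x := fun i => LinearMap.mulLeft F (v ((i : ℕ) + 2)))
    (y := fun i => LinearMap.mulLeft F (∑ c, g ((i : ℕ) + 2) c ⊗ₜ[F] e c)) ?_
    (v 0 * v 1, v 0 * v 1) ⟨v 0 * v 1, Submodule.subset_span ⟨_, _, rfl⟩, rfl⟩
  · obtain ⟨m, _, hm⟩ := h
    have h1 := congrArg Prod.fst hm
    have h2 := congrArg Prod.snd hm
    refine h1.symm.trans (h2.trans ?_)
    -- The operators come from Grassmann combinations of endomorphisms of `B`, an associative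
    -- setting where the counting argument applies.
    have h3 : (fun i : Fin K => LinearMap.mulLeft F (∑ c, g ((i : ℕ) + 2) c ⊗ₜ[F] e c)) =
        fun i : Fin K => tensorEnd F B.carrier
          (∑ c, g ((i : ℕ) + 2) c ⊗ₜ[F] LinearMap.mulLeft F (e c)) := by
      funext i
      simp only [map_sum, tensorEnd_mulLeft]
      refine LinearMap.ext fun m => ?_
      rw [LinearMap.mulLeft_apply, Finset.sum_mul, LinearMap.sum_apply]
      rfl
    dsimp only
    rw [h3, ← map_standardPoly, ← map_pow,
      standardPoly_pow_eq_zero hKL (fun i => g ((i : ℕ) + 2)) (fun i c => hg _ (.inl c))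
        (fun i c => hg _ (.inr c)), map_zero, LinearMap.zero_apply]
  · rintro i _ ⟨m, hm, rfl⟩
    refine ⟨v (i + 2) * m, Submodule.subset_span ⟨_, _, rfl⟩, Prod.ext rfl ?_⟩
    change v (i + 2) * m = (∑ c, g ((i : ℕ) + 2) c ⊗ₜ[F] e c) * m
    induction hm using Submodule.span_induction with
    | mem m h =>
      obtain ⟨a, b, rfl⟩ := h
      exact hgv _ a b
    | zero => rw [mul_zero, mul_zero]
    | add x y _ _ hx hy => rw [mul_add, mul_add, hx, hy]
    | smul k x _ hx => rw [mul_smul_comm, mul_smul_comm, hx]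

end Metabelian

/-! ### Generated varieties and supervarieties in terms of identities. -/

section VarietyFacts

variable {F : Type u} [Field F]

theorem mem_varietyGenerated_self (A : Alg F) : A ∈ varietyGenerated A :=
  Set.mem_sInter.2 fun _ hV => hV.2

theorem varietyGenerated_subset {A : Alg F} {V : Set (Alg F)} (hV : IsVariety V) (hA : A ∈ V) :
    varietyGenerated A ⊆ V :=
  Set.sInter_subset_of_mem ⟨hV, hA⟩

theorem isVariety_satisfying (A : Alg F) :
    IsVariety {B : Alg F | ∀ f, A.Satisfies f → B.Satisfies f} :=
  ⟨{f | A.Satisfies f}, rfl⟩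

theorem varietyGenerated_eq (A : Alg F) :
    varietyGenerated A = {B : Alg F | ∀ f, A.Satisfies f → B.Satisfies f} := by
  refine Set.Subset.antisymm (varietyGenerated_subset (isVariety_satisfying A) fun _ h => h) ?_
  intro B hB
  refine Set.mem_sInter.2 ?_
  rintro _ ⟨⟨S, rfl⟩, hA⟩
  exact fun f hf => hB f (hA f hf)

theorem isVariety_varietyGenerated (A : Alg F) : IsVariety (varietyGenerated A) := by
  rw [varietyGenerated_eq]
  exact isVariety_satisfying A

theorem isVariety_metabelian : IsVariety (metabelian F) := by
  let x : ℕ → FreeNonUnitalNonAssocAlgebra F ℕ := FreeNonUnitalNonAssocAlgebra.of F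
  refine ⟨{(x 0 * x 1) * (x 2 * x 3)}, Set.ext fun A => ?_⟩
  have hx : ∀ (v : ℕ → A.carrier),
      FreeNonUnitalNonAssocAlgebra.lift F v ((x 0 * x 1) * (x 2 * x 3)) =
        (v 0 * v 1) * (v 2 * v 3) := fun v => by
    simp only [map_mul, x, FreeNonUnitalNonAssocAlgebra.lift_of_apply]
  constructor
  · rintro h _ rfl v
    rw [hx]
    exact h _ _ _ _
  · intro h a b c d
    have := h _ rfl (fun n => if n = 0 then a else if n = 1 then b else if n = 2 then c else d)
    rwa [hx] at this

theorem superClass_mono {V W : Set (Alg F)} (h : V ⊆ W) : superClass V ⊆ superClass W :=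
  fun _ hA => h hA

theorem supervarietyGenerated_eq (A : SuperAlg F) :
    supervarietyGenerated A = superClass (varietyGenerated A.envelope) := by
  refine Set.Subset.antisymm (Set.sInter_subset_of_mem
    ⟨⟨_, isVariety_varietyGenerated _, rfl⟩, mem_varietyGenerated_self _⟩) ?_
  refine Set.subset_sInter ?_
  rintro _ ⟨⟨V, hV, rfl⟩, hA⟩
  exact superClass_mono (varietyGenerated_subset hV hA)

end VarietyFacts

/-! ### Free superalgebras: relations, generators, universal property. -/

section FreeFacts

variable {F : Type u} [Field F]

/-- The graded ideal of the absolutely free superalgebra that defines the free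
`V`-superalgebra. -/
noncomputable def relIdeal (V : Set (Alg F)) (r s : ℕ) :
    SuperIdeal (absFree F (Fin r) (Fin s)) :=
  SuperIdeal.sInf {J | J.quotient ∈ superClass V}

theorem free_eq (V : Set (Alg F)) (r s : ℕ) : free V r s = (relIdeal V r s).quotient := rfl

theorem mem_relIdeal {V : Set (Alg F)} {r s : ℕ} {x : (absFree F (Fin r) (Fin s)).carrier} :
    x ∈ (relIdeal V r s).toSubmodule ↔
      ∀ J : SuperIdeal (absFree F (Fin r) (Fin s)), J.quotient ∈ superClass V →
        x ∈ J.toSubmodule := by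
  simp only [relIdeal, SuperIdeal.sInf, Submodule.mem_iInf]
  rfl

theorem SuperIdeal.ext_mem {A : SuperAlg F} {I J : SuperIdeal A}
    (h : ∀ x, x ∈ I.toSubmodule ↔ x ∈ J.toSubmodule) : I = J := by
  obtain ⟨I, _, _, _⟩ := I
  obtain ⟨J, _, _, _⟩ := J
  obtain rfl : I = J := Submodule.ext h
  rfl

/-- Every ideal in the defining intersection has a metabelian quotient, so it contains all the
products in question. -/
theorem free_metabelian {V : Set (Alg F)} (hV : V ⊆ metabelian F) (r s : ℕ)
    (a b c d : (free V r s).carrier) : (a * b) * (c * d) = 0 := by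
  obtain ⟨a, rfl⟩ := (relIdeal V r s).proj_surjective a
  obtain ⟨b, rfl⟩ := (relIdeal V r s).proj_surjective b
  obtain ⟨c, rfl⟩ := (relIdeal V r s).proj_surjective c
  obtain ⟨d, rfl⟩ := (relIdeal V r s).proj_surjective d
  change ((relIdeal V r s).proj a * (relIdeal V r s).proj b) *
    ((relIdeal V r s).proj c * (relIdeal V r s).proj d) = 0
  rw [← SuperIdeal.proj_mul, ← SuperIdeal.proj_mul, ← SuperIdeal.proj_mul,
    SuperIdeal.proj_eq_zero, mem_relIdeal]
  intro J hJ
  rw [← SuperIdeal.proj_eq_zero, SuperIdeal.proj_mul, SuperIdeal.proj_mul, SuperIdeal.proj_mul]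
  exact metabelian_of_envelope (B := J.quotient) (hV hJ) _ _ _ _

/-- The free metabelian superalgebra is also free in the variety generated by its envelope. -/
theorem free_varietyGenerated (r s : ℕ) :
    free (varietyGenerated (free (metabelian F) r s).envelope) r s =
      free (metabelian F) r s := by
  have hN : varietyGenerated (free (metabelian F) r s).envelope ⊆ metabelian F :=
    varietyGenerated_subset isVariety_metabelian
      (envelope_mem_metabelian (free_metabelian subset_rfl r s))
  rw [free_eq, free_eq]
  refine congrArg SuperIdeal.quotient (SuperIdeal.ext_mem fun x => ⟨fun h => ?_, fun h => ?_⟩)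
  -- The metabelian relation ideal is itself one of the ideals intersected, because the envelope of
  -- its quotient generates the variety.
  · exact mem_relIdeal.1 h _ (mem_varietyGenerated_self _)
  · exact mem_relIdeal.2 fun J hJ => mem_relIdeal.1 h J (hN hJ)

theorem absFree_part_le {X Y : Type} {i : ZMod 2} {T : Submodule F (absFree F X Y).carrier}
    (h : ∀ w : FreeMagma (X ⊕ Y), parity w = i →
      (MonoidAlgebra.single w 1 : FreeNonUnitalNonAssocAlgebra F (X ⊕ Y)) ∈ T) :
    (absFree F X Y).part i ≤ T := by
  have h1 : (absFree F X Y).part i = Submodule.span F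
      ((fun w => (MonoidAlgebra.single w 1 : FreeNonUnitalNonAssocAlgebra F (X ⊕ Y))) ''
        {w | parity w = i}) := MonoidAlgebra.supported_eq_span_single _ _
  rw [h1]
  refine Submodule.span_le.2 ?_
  rintro _ ⟨w, hw, rfl⟩
  exact h w hw

/-- The projection of the absolutely free superalgebra onto the free `V`-superalgebra. -/
noncomputable def freeProj (V : Set (Alg F)) (r s : ℕ) :
    (absFree F (Fin r) (Fin s)).carrier →ₗ[F] (free V r s).carrier :=
  (relIdeal V r s).proj

/-- The generators of the free `V`-superalgebra. -/
noncomputable def freeGen (V : Set (Alg F)) (r s : ℕ) (c : Fin r ⊕ Fin s) :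
    (free V r s).carrier :=
  (relIdeal V r s).proj (FreeNonUnitalNonAssocAlgebra.of F c)

theorem single_mem_part {X Y : Type} (w : FreeMagma (X ⊕ Y)) :
    (MonoidAlgebra.single w 1 : FreeNonUnitalNonAssocAlgebra F (X ⊕ Y)) ∈
      (absFree F X Y).part (parity w) := by
  change _ ∈ MonoidAlgebra.supported F F _
  rw [MonoidAlgebra.supported_eq_span_single]
  exact Submodule.subset_span ⟨w, rfl, rfl⟩

theorem single_word_mul {X : Type} (a b : FreeMagma X) :
    (MonoidAlgebra.single (a * b) 1 : FreeNonUnitalNonAssocAlgebra F X) =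
      MonoidAlgebra.single a 1 * MonoidAlgebra.single b 1 := by
  rw [MonoidAlgebra.single_mul_single, one_mul]

theorem parity_of {X Y : Type} (c : X ⊕ Y) : parity (FreeMagma.of c) = genParity c := by
  cases c <;> rfl

theorem freeGen_mem (V : Set (Alg F)) (r s : ℕ) (c : Fin r ⊕ Fin s) :
    freeGen V r s c ∈ (free V r s).part (genParity c) := by
  rw [← parity_of]
  exact ⟨_, single_mem_part (FreeMagma.of c), rfl⟩

/-- A word is either a single letter or a product of two words. This is the spanning condition
required by `satisfies_hookPoly`. -/
theorem free_part_le (V : Set (Alg F)) (r s : ℕ) (i : ZMod 2) :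
    (free V r s).part i ≤ Submodule.span F (freeGen V r s '' {c | genParity c = i}) ⊔
      squareSpan F (free V r s).carrier := by
  have h : (absFree F (Fin r) (Fin s)).part i ≤
      (Submodule.span F (freeGen V r s '' {c | genParity c = i}) ⊔
        squareSpan F (free V r s).carrier).comap (freeProj V r s) := by
    refine absFree_part_le fun w hw => ?_
    cases w with
    | of c =>
      exact Submodule.mem_sup_left
        (Submodule.subset_span ⟨c, (parity_of c).symm.trans hw, rfl⟩)
    | mul a b =>
      refine Submodule.mem_sup_right (Submodule.subset_span
        ⟨freeProj V r s (MonoidAlgebra.single a 1), freeProj V r s (MonoidAlgebra.single b 1), ?_⟩)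
      refine Eq.trans ?_ ((relIdeal V r s).proj_mul _ _)
      exact congrArg (relIdeal V r s).proj (single_word_mul a b)
  rintro _ ⟨x, hx, rfl⟩
  exact h hx

/-- The kernel of a graded homomorphism, as a graded ideal. -/
def kerIdeal {A B : SuperAlg F} (φ : A.carrier →ₙₐ[F] B.carrier)
    (hφ : ∀ i, ∀ a ∈ A.part i, φ a ∈ B.part i) : SuperIdeal A where
  toSubmodule := LinearMap.ker (φ : A.carrier →ₗ[F] B.carrier)
  mul_left a x hx := by
    have hx' : φ x = 0 := hx
    change φ (a * x) = 0
    rw [map_mul, hx', mul_zero]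
  mul_right a x hx := by
    have hx' : φ x = 0 := hx
    change φ (x * a) = 0
    rw [map_mul, hx', zero_mul]
  homogeneous {x y} hx hy hxy := by
    have h : φ x + φ y = 0 := (map_add φ x y).symm.trans hxy
    have hx0 : φ x = 0 := Submodule.disjoint_def.1 B.isCompl.disjoint _ (hφ 0 x hx) (by
      rw [eq_neg_of_add_eq_zero_left h]
      exact neg_mem (hφ 1 y hy))
    exact ⟨hx0, by rwa [hx0, zero_add] at h⟩

/-- The universal property of the free metabelian superalgebra. -/
theorem exists_hom_free {C : SuperAlg F} (hC : ∀ a b c d : C.carrier, (a * b) * (c * d) = 0)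
    {r s : ℕ} (e : Fin r ⊕ Fin s → C.carrier) (he : ∀ c, e c ∈ C.part (genParity c)) :
    ∃ φ : (free (metabelian F) r s).carrier →ₙₐ[F] C.carrier,
      ∀ c, φ (freeGen (metabelian F) r s c) = e c := by
  let ψ : (absFree F (Fin r) (Fin s)).carrier →ₙₐ[F] C.carrier :=
    FreeNonUnitalNonAssocAlgebra.lift F e
  have hψ : ∀ i, ∀ a ∈ (absFree F (Fin r) (Fin s)).part i, ψ a ∈ C.part i := by
    intro i
    refine absFree_part_le
      (T := (C.part i).comap (ψ : (absFree F (Fin r) (Fin s)).carrier →ₗ[F] C.carrier)) ?_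
    rintro w rfl
    change ψ (MonoidAlgebra.single w 1) ∈ C.part (parity w)
    induction w with
    | ih1 c =>
      have h : ψ (MonoidAlgebra.single (FreeMagma.of c) 1) = e c :=
        FreeNonUnitalNonAssocAlgebra.lift_of_apply F e c
      change ψ (MonoidAlgebra.single (FreeMagma.of c) 1) ∈ C.part (parity (FreeMagma.of c))
      rw [h, parity_of]
      exact he c
    | ih2 a b ha hb =>
      have h' := (congrArg ψ (single_word_mul a b)).trans (map_mul ψ _ _)
      change ψ (MonoidAlgebra.single (a * b) 1) ∈ C.part (parity (a * b))
      rw [h', parity_mul]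
      exact C.mul_mem ha hb
  -- The quotient by the kernel of `ψ` inherits the metabelian identity from `C`, so this kernel
  -- takes part in the defining intersection.
  have hker : (relIdeal (metabelian F) r s).toSubmodule ≤
      LinearMap.ker (ψ : (absFree F (Fin r) (Fin s)).carrier →ₗ[F] C.carrier) := by
    intro x hx
    refine mem_relIdeal.1 hx (kerIdeal ψ hψ) (envelope_mem_metabelian ?_)
    intro a b c d
    obtain ⟨a, rfl⟩ := (kerIdeal ψ hψ).proj_surjective a
    obtain ⟨b, rfl⟩ := (kerIdeal ψ hψ).proj_surjective b
    obtain ⟨c, rfl⟩ := (kerIdeal ψ hψ).proj_surjective c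
    obtain ⟨d, rfl⟩ := (kerIdeal ψ hψ).proj_surjective d
    change ((kerIdeal ψ hψ).proj a * (kerIdeal ψ hψ).proj b) *
      ((kerIdeal ψ hψ).proj c * (kerIdeal ψ hψ).proj d) = 0
    rw [← SuperIdeal.proj_mul, ← SuperIdeal.proj_mul, ← SuperIdeal.proj_mul,
      SuperIdeal.proj_eq_zero]
    change ψ _ = 0
    rw [map_mul, map_mul, map_mul]
    exact hC _ _ _ _
  let φ : (free (metabelian F) r s).carrier →ₗ[F] C.carrier :=
    (relIdeal (metabelian F) r s).toSubmodule.liftQ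
      (ψ : (absFree F (Fin r) (Fin s)).carrier →ₗ[F] C.carrier) hker
  have hφ : ∀ x, φ ((relIdeal (metabelian F) r s).proj x) = ψ x := fun x => rfl
  refine ⟨{ φ with
    map_zero' := map_zero φ
    map_mul' := fun x y => ?_ }, fun c => ?_⟩
  · obtain ⟨x, rfl⟩ := (relIdeal (metabelian F) r s).proj_surjective x
    obtain ⟨y, rfl⟩ := (relIdeal (metabelian F) r s).proj_surjective y
    change φ ((relIdeal (metabelian F) r s).proj x * (relIdeal (metabelian F) r s).proj y) =
      φ ((relIdeal (metabelian F) r s).proj x) * φ ((relIdeal (metabelian F) r s).proj y)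
    rw [← SuperIdeal.proj_mul, hφ, hφ, hφ, map_mul]
  · exact FreeNonUnitalNonAssocAlgebra.lift_of_apply F e c

/-- An identity of the envelope of the free metabelian superalgebra vanishes on Grassmann
combinations of homogeneous elements of any metabelian superalgebra. -/
theorem lift_eq_zero_of_satisfies {C : SuperAlg F}
    (hC : ∀ a b c d : C.carrier, (a * b) * (c * d) = 0)
    {r s : ℕ} (e : Fin r ⊕ Fin s → C.carrier) (he : ∀ c, e c ∈ C.part (genParity c))
    {f : FreeNonUnitalNonAssocAlgebra F ℕ}
    (hf : (free (metabelian F) r s).envelope.Satisfies f)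
    (g : ℕ → Fin r ⊕ Fin s → Grassmann F)
    (hg : ∀ n c, g n c ∈ Grassmann.part F (genParity c)) :
    FreeNonUnitalNonAssocAlgebra.lift F (fun n => ∑ c, g n c ⊗ₜ[F] e c) f = 0 := by
  obtain ⟨φ, hφ⟩ := exists_hom_free hC e he
  rw [SuperAlg.envelope_satisfies_iff] at hf
  have h := hf (fun n => ∑ c, g n c ⊗ₜ[F] freeGen (metabelian F) r s c) fun n =>
    Submodule.sum_mem _ fun c _ => SuperAlg.tmul_mem_envelope _ (hg n c) (freeGen_mem _ r s c)
  have h' := (map_lift (tensorMap φ) _ f).symm.trans ((congrArg (tensorMap φ) h).trans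
    (map_zero _))
  simpa only [map_sum, tensorMap_tmul, hφ] using h'

end FreeFacts

/-! ### Path algebras, metabelian models in which the identities can be computed. -/

section PathAlgebra

variable {F : Type u} [Field F] {r s : ℕ}

/-- The space spanned by letters and by the vertices of an infinite path labelled by the
letters `c 0, c 1, …`. -/
def PathSpace (F : Type u) [Field F] {r s : ℕ} (_c : ℕ → Fin r ⊕ Fin s) (_l : Fin r ⊕ Fin s) :
    Type u :=
  (Fin r ⊕ Fin s → F) × (ℕ → F)

namespace PathSpace

variable {c : ℕ → Fin r ⊕ Fin s} {l : Fin r ⊕ Fin s}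

instance : AddCommGroup (PathSpace F c l) :=
  inferInstanceAs (AddCommGroup ((Fin r ⊕ Fin s → F) × (ℕ → F)))

instance : Module F (PathSpace F c l) :=
  inferInstanceAs (Module F ((Fin r ⊕ Fin s → F) × (ℕ → F)))

/-- The coefficients of the vertices in a product. -/
def mulCoeff (x y : PathSpace F c l) : ℕ → F
  | 0 => x.1 l * y.1 l
  | k + 1 => x.1 (c k) * y.2 k

/-- The letter `c k` sends the vertex `k` to the vertex `k + 1`, and the square of the letter `l`
is the vertex `0`. -/
instance : Mul (PathSpace F c l) := ⟨fun x y => (0, mulCoeff x y)⟩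

/-- The element with given coefficients. -/
def mk (p : Fin r ⊕ Fin s → F) (q : ℕ → F) : PathSpace F c l := (p, q)

theorem mk_fst (p : Fin r ⊕ Fin s → F) (q : ℕ → F) (a : Fin r ⊕ Fin s) :
    (mk p q : PathSpace F c l).1 a = p a := rfl
theorem mk_snd (p : Fin r ⊕ Fin s → F) (q : ℕ → F) (k : ℕ) :
    (mk p q : PathSpace F c l).2 k = q k := rfl

theorem ext {x y : PathSpace F c l} (h1 : ∀ a, x.1 a = y.1 a) (h2 : ∀ k, x.2 k = y.2 k) :
    x = y :=
  Prod.ext (funext h1) (funext h2)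

theorem mul_fst (x y : PathSpace F c l) (a : Fin r ⊕ Fin s) : (x * y).1 a = 0 := rfl
theorem mul_snd_zero (x y : PathSpace F c l) : (x * y).2 0 = x.1 l * y.1 l := rfl
theorem mul_snd_succ (x y : PathSpace F c l) (k : ℕ) :
    (x * y).2 (k + 1) = x.1 (c k) * y.2 k := rfl
theorem add_fst (x y : PathSpace F c l) (a : Fin r ⊕ Fin s) : (x + y).1 a = x.1 a + y.1 a := rfl
theorem add_snd (x y : PathSpace F c l) (k : ℕ) : (x + y).2 k = x.2 k + y.2 k := rfl
theorem smul_fst (t : F) (x : PathSpace F c l) (a : Fin r ⊕ Fin s) :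
    (t • x).1 a = t * x.1 a := rfl
theorem smul_snd (t : F) (x : PathSpace F c l) (k : ℕ) : (t • x).2 k = t * x.2 k := rfl
theorem zero_fst (a : Fin r ⊕ Fin s) : (0 : PathSpace F c l).1 a = 0 := rfl
theorem zero_snd (k : ℕ) : (0 : PathSpace F c l).2 k = 0 := rfl

instance : NonUnitalNonAssocRing (PathSpace F c l) where
  left_distrib x y z := by
    refine ext (fun a => by simp [mul_fst, add_fst]) fun k => ?_
    cases k <;> simp only [mul_snd_zero, mul_snd_succ, add_fst, add_snd] <;> ring
  right_distrib x y z := by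
    refine ext (fun a => by simp [mul_fst, add_fst]) fun k => ?_
    cases k <;> simp only [mul_snd_zero, mul_snd_succ, add_fst, add_snd] <;> ring
  zero_mul x := by
    refine ext (fun a => rfl) fun k => ?_
    cases k <;> simp only [mul_snd_zero, mul_snd_succ, zero_fst, zero_snd, zero_mul]
  mul_zero x := by
    refine ext (fun a => rfl) fun k => ?_
    cases k <;> simp only [mul_snd_zero, mul_snd_succ, zero_fst, zero_snd, mul_zero]

instance : IsScalarTower F (PathSpace F c l) (PathSpace F c l) where
  smul_assoc t x y := by
    refine ext (fun a => by simp only [smul_eq_mul, mul_fst, smul_fst, mul_zero]) fun k => ?_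
    cases k <;>
      simp only [smul_eq_mul, mul_snd_zero, mul_snd_succ, smul_fst, smul_snd, mul_assoc]

instance : SMulCommClass F (PathSpace F c l) (PathSpace F c l) where
  smul_comm t x y := by
    refine ext (fun a => by simp only [smul_eq_mul, mul_fst, smul_fst, mul_zero]) fun k => ?_
    cases k <;>
      simp only [smul_eq_mul, mul_snd_zero, mul_snd_succ, smul_fst, smul_snd, mul_left_comm]

theorem mul_mul_mul_eq_zero (x y z t : PathSpace F c l) : (x * y) * (z * t) = 0 := by
  refine ext (fun a => rfl) fun k => ?_
  cases k <;> simp only [mul_snd_zero, mul_snd_succ, mul_fst, zero_snd, zero_mul]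

/-- The parity of a vertex. -/
def vertexParity (c : ℕ → Fin r ⊕ Fin s) (l : Fin r ⊕ Fin s) : ℕ → ZMod 2
  | 0 => genParity l + genParity l
  | k + 1 => genParity (c k) + vertexParity c l k

/-- The homogeneous components of the path algebra. -/
def part (i : ZMod 2) : Submodule F (PathSpace F c l) where
  carrier := {x | (∀ a, genParity a ≠ i → x.1 a = 0) ∧ ∀ k, vertexParity c l k ≠ i → x.2 k = 0}
  zero_mem' := ⟨fun _ _ => rfl, fun _ _ => rfl⟩
  add_mem' {x y} hx hy :=
    ⟨fun a ha => by rw [add_fst, hx.1 a ha, hy.1 a ha, add_zero],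
      fun k hk => by rw [add_snd, hx.2 k hk, hy.2 k hk, add_zero]⟩
  smul_mem' t x hx :=
    ⟨fun a ha => by rw [smul_fst, hx.1 a ha, mul_zero],
      fun k hk => by rw [smul_snd, hx.2 k hk, mul_zero]⟩

/-- The path superalgebra. -/
def superAlg (F : Type u) [Field F] (c : ℕ → Fin r ⊕ Fin s) (l : Fin r ⊕ Fin s) : SuperAlg F where
  carrier := PathSpace F c l
  part := part
  isCompl := by
    constructor
    · rw [Submodule.disjoint_def]
      intro x h0 h1
      refine ext (fun a => ?_) fun k => ?_
      · by_cases h : genParity a = 0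
        · exact h1.1 a (by rw [h]; decide)
        · exact h0.1 a h
      · by_cases h : vertexParity c l k = 0
        · exact h1.2 k (by rw [h]; decide)
        · exact h0.2 k h
    · rw [codisjoint_iff, eq_top_iff]
      intro x _
      have h01 : ∀ i : ZMod 2, i ≠ 1 → i = 0 := by decide
      refine Submodule.mem_sup.2
        ⟨mk (fun a => if genParity a = 0 then x.1 a else 0)
          (fun k => if vertexParity c l k = 0 then x.2 k else 0),
          ⟨fun a ha => if_neg ha, fun k hk => if_neg hk⟩,
        mk (fun a => if genParity a = 0 then 0 else x.1 a)
          (fun k => if vertexParity c l k = 0 then 0 else x.2 k),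
          ⟨fun a ha => if_pos (h01 _ ha), fun k hk => if_pos (h01 _ hk)⟩, ?_⟩
      refine ext (fun a => ?_) fun k => ?_
      · rw [add_fst, mk_fst, mk_fst]
        split_ifs
        · exact add_zero _
        · exact zero_add _
      · rw [add_snd, mk_snd, mk_snd]
        split_ifs
        · exact add_zero _
        · exact zero_add _
  mul_mem {i j x y} hx hy := by
    refine ⟨fun a _ => rfl, fun k hk => ?_⟩
    cases k with
    | zero =>
      rw [mul_snd_zero]
      by_cases hi : genParity l = i
      · have hj : genParity l ≠ j := by
          rintro rfl
          exact hk (by rw [← hi]; rfl)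
        rw [hy.1 l hj, mul_zero]
      · rw [hx.1 l hi, zero_mul]
    | succ k =>
      rw [mul_snd_succ]
      by_cases hi : genParity (c k) = i
      · have hj : vertexParity c l k ≠ j := by
          rintro rfl
          exact hk (by rw [← hi]; rfl)
        rw [hy.2 k hj, mul_zero]
      · rw [hx.1 _ hi, zero_mul]

/-- A letter, as an element of the path algebra. -/
def letter (c : ℕ → Fin r ⊕ Fin s) (l a : Fin r ⊕ Fin s) : PathSpace F c l :=
  mk (Pi.single a 1) 0

/-- A vertex, as an element of the path algebra. -/
def vertex (c : ℕ → Fin r ⊕ Fin s) (l : Fin r ⊕ Fin s) (k : ℕ) : PathSpace F c l :=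
  mk 0 (Pi.single k 1)

theorem letter_mem (a : Fin r ⊕ Fin s) :
    (letter c l a : PathSpace F c l) ∈ part (genParity a) :=
  ⟨fun _ hb => Pi.single_eq_of_ne (fun h => hb (by rw [h])) _, fun _ _ => rfl⟩

theorem letter_fst (a b : Fin r ⊕ Fin s) :
    (letter c l a : PathSpace F c l).1 b = if b = a then 1 else 0 := Pi.single_apply _ _ _
theorem letter_snd (a : Fin r ⊕ Fin s) (k : ℕ) : (letter c l a : PathSpace F c l).2 k = 0 := rfl
theorem vertex_fst (k : ℕ) (b : Fin r ⊕ Fin s) : (vertex c l k : PathSpace F c l).1 b = 0 := rfl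
theorem vertex_snd (k j : ℕ) :
    (vertex c l k : PathSpace F c l).2 j = if j = k then 1 else 0 := Pi.single_apply _ _ _

theorem vertex_ne_zero (k : ℕ) : (vertex c l k : PathSpace F c l) ≠ 0 := fun h => by
  have h1 : (vertex c l k : PathSpace F c l).2 k = 0 := by rw [h, zero_snd]
  rw [vertex_snd, if_pos rfl] at h1
  exact one_ne_zero h1

theorem letter_mul_letter : (letter c l l * letter c l l : PathSpace F c l) = vertex c l 0 := by
  refine ext (fun a => rfl) fun k => ?_
  cases k with
  | zero => rw [mul_snd_zero, letter_fst, vertex_snd, if_pos rfl, if_pos rfl, mul_one]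
  | succ k => rw [mul_snd_succ, letter_snd, mul_zero, vertex_snd, if_neg k.succ_ne_zero]

theorem letter_mul_vertex (k : ℕ) :
    (letter c l (c k) * vertex c l k : PathSpace F c l) = vertex c l (k + 1) := by
  refine ext (fun a => rfl) fun j => ?_
  cases j with
  | zero => rw [mul_snd_zero, vertex_fst, mul_zero, vertex_snd, if_neg k.succ_ne_zero.symm]
  | succ j =>
    rw [mul_snd_succ, letter_fst, vertex_snd, vertex_snd]
    by_cases h : j = k
    · rw [h, if_pos rfl, if_pos rfl, if_pos rfl, mul_one]
    · rw [if_neg h, if_neg fun h' => h (Nat.succ_injective h'), mul_zero]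

theorem letter_mul_vertex_of_ne {a : Fin r ⊕ Fin s} {k : ℕ} (h : a ≠ c k) :
    (letter c l a * vertex c l k : PathSpace F c l) = 0 := by
  refine ext (fun a => rfl) fun j => ?_
  cases j with
  | zero => rw [mul_snd_zero, vertex_fst, mul_zero, zero_snd]
  | succ j =>
    rw [mul_snd_succ, letter_fst, vertex_snd, zero_snd]
    by_cases hj : j = k
    · rw [hj, if_neg h.symm, zero_mul]
    · rw [if_neg hj, mul_zero]

theorem mulLeft_vertex (g : Fin r ⊕ Fin s → Grassmann F) (h : Grassmann F) (k : ℕ) :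
    LinearMap.mulLeft F (∑ a, g a ⊗ₜ[F] (letter c l a : PathSpace F c l))
      (h ⊗ₜ[F] vertex c l k) = (g (c k) * h) ⊗ₜ[F] vertex c l (k + 1) := by
  rw [LinearMap.mulLeft_apply, Finset.sum_mul, Finset.sum_eq_single (c k)]
  · rw [Algebra.TensorProduct.tmul_mul_tmul, letter_mul_vertex]
  · intro a _ ha
    rw [Algebra.TensorProduct.tmul_mul_tmul, letter_mul_vertex_of_ne ha, TensorProduct.tmul_zero]
  · exact fun h => absurd (Finset.mem_univ _) h

/-- The rightmost operator acts first, so the `i`-th factor meets the vertex `k + i.rev`. -/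
theorem list_prod_vertex {K : ℕ} (T : Fin K → Module.End F (Grassmann F ⊗[F] PathSpace F c l))
    (a : Fin K → ℕ → Grassmann F)
    (hT : ∀ i h k, T i (h ⊗ₜ[F] vertex c l k) = (a i k * h) ⊗ₜ[F] vertex c l (k + 1))
    (h : Grassmann F) (k : ℕ) :
    (List.ofFn T).prod (h ⊗ₜ[F] vertex c l k) =
      ((List.ofFn fun i => a i (k + i.rev)).prod * h) ⊗ₜ[F] vertex c l (k + K) := by
  induction K with
  | zero => simp
  | succ K ih =>
    rw [List.ofFn_succ, List.prod_cons, List.ofFn_succ, List.prod_cons, Module.End.mul_apply,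
      ih (fun i => T i.succ) (fun i => a i.succ) (fun i => hT i.succ), hT]
    simp only [Fin.rev_succ, Fin.val_castSucc, Fin.rev_zero, Fin.val_last, mul_assoc, add_assoc]

theorem standardPoly_vertex {K : ℕ} (T : Fin K → Module.End F (Grassmann F ⊗[F] PathSpace F c l))
    (a : Fin K → ℕ → Grassmann F)
    (hT : ∀ i h k, T i (h ⊗ₜ[F] vertex c l k) = (a i k * h) ⊗ₜ[F] vertex c l (k + 1))
    (h : Grassmann F) (k : ℕ) :
    standardPoly F _ K T (h ⊗ₜ[F] vertex c l k) =
      ((∑ σ : Equiv.Perm (Fin K), Equiv.Perm.sign σ •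
        (List.ofFn fun i => a (σ i) (k + i.rev)).prod) * h) ⊗ₜ[F] vertex c l (k + K) := by
  rw [standardPoly_apply, LinearMap.sum_apply, Finset.sum_mul, TensorProduct.sum_tmul]
  refine Finset.sum_congr rfl fun σ _ => ?_
  have := list_prod_vertex (fun i => T (σ i)) (fun i => a (σ i)) (fun i => hT (σ i)) h k
  rw [Units.smul_def, Units.smul_def, LinearMap.smul_apply, this, smul_mul_assoc,
    ← TensorProduct.smul_tmul']

/-- An identity `hookPoly` of the free metabelian superalgebra holds in the path algebra. -/
theorem standardPoly_pow_eq_zero_of_satisfies (c : ℕ → Fin r ⊕ Fin s) (l : Fin r ⊕ Fin s)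
    {K L : ℕ} (hf : (free (metabelian F) r s).envelope.Satisfies (hookPoly F K L))
    (g : ℕ → Fin r ⊕ Fin s → Grassmann F)
    (hg : ∀ n c, g n c ∈ Grassmann.part F (genParity c))
    (h0 : ∀ a, a ≠ l → g 0 a = 0) (h1 : ∀ a, a ≠ l → g 1 a = 0) :
    (standardPoly F (Module.End F (Grassmann F ⊗[F] PathSpace F c l)) K
      (fun i => LinearMap.mulLeft F (∑ a, g ((i : ℕ) + 2) a ⊗ₜ[F] letter c l a)) ^ L)
        ((g 0 l * g 1 l) ⊗ₜ[F] vertex c l 0) = 0 := by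
  have h : FreeNonUnitalNonAssocAlgebra.lift F
      (fun n => ∑ a, g n a ⊗ₜ[F] (letter c l a : PathSpace F c l)) (hookPoly F K L) = 0 :=
    lift_eq_zero_of_satisfies (C := superAlg F c l) mul_mul_mul_eq_zero (letter c l) letter_mem hf g hg
  have hsum : ∀ n, (∀ a, a ≠ l → g n a = 0) →
      ∑ a, g n a ⊗ₜ[F] (letter c l a : PathSpace F c l) = g n l ⊗ₜ[F] letter c l l := by
    intro n hn
    refine Finset.sum_eq_single l (fun a _ ha => ?_) fun h => absurd (Finset.mem_univ _) h
    rw [hn a ha, TensorProduct.zero_tmul]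
  rw [lift_hookPoly] at h
  simp only [hsum 0 h0, hsum 1 h1] at h
  rwa [Algebra.TensorProduct.tmul_mul_tmul, letter_mul_letter] at h

end PathSpace

/-! ### Failure of the identities when enough even or odd generators are present. -/

theorem sum_sign_smul_prod_ite {R : Type*} [Ring R] (K : ℕ) :
    ∑ σ : Equiv.Perm (Fin K), Equiv.Perm.sign σ •
      (List.ofFn fun i => if σ i = i then (1 : R) else 0).prod = 1 := by
  rw [Finset.sum_eq_single 1]
  · simp
  · intro σ _ hσ
    obtain ⟨i, hi⟩ : ∃ i, σ i ≠ i := by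
      by_contra! h
      exact hσ (Equiv.ext h)
    rw [List.prod_eq_zero (List.mem_ofFn.2 ⟨i, if_neg hi⟩), smul_zero]
  · exact fun h => absurd (Finset.mem_univ _) h

/-- Permuting anticommuting generators produces the sign of the permutation again, so the signs
cancel and all `K!` terms coincide. -/
theorem sum_sign_smul_prod_gen (F : Type u) [Field F] (K : ℕ) (n : Fin K → ℕ) :
    ∑ σ : Equiv.Perm (Fin K), Equiv.Perm.sign σ •
      (List.ofFn fun i => Grassmann.gen F (n (σ i))).prod =
        (K.factorial : F) • (List.ofFn fun i => Grassmann.gen F (n i)).prod := by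
  have h : ∀ σ : Equiv.Perm (Fin K), Equiv.Perm.sign σ •
      (List.ofFn fun i => Grassmann.gen F (n (σ i))).prod =
        (List.ofFn fun i => Grassmann.gen F (n i)).prod := by
    intro σ
    have h1 := (ExteriorAlgebra.ιMulti F K).map_perm (fun i => Finsupp.single (n i) (1 : F)) σ
    rw [ExteriorAlgebra.ιMulti_apply, ExteriorAlgebra.ιMulti_apply] at h1
    refine (congrArg (Equiv.Perm.sign σ • ·) h1).trans ?_
    rw [smul_smul, Int.units_mul_self, one_smul]
    rfl
  rw [Finset.sum_congr rfl fun σ _ => h σ, Finset.sum_const, Finset.card_univ,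
    Fintype.card_perm, Fintype.card_fin, Nat.cast_smul_eq_nsmul]

/-- `hookPoly` with at most `r` rows is not an identity of the free metabelian superalgebra. -/
theorem not_satisfies_of_even {K : ℕ} (L : ℕ) (hK : K + 1 ≤ r) :
    ¬ (free (metabelian F) r s).envelope.Satisfies (hookPoly F (K + 1) L) := by
  intro hf
  let x : Fin (K + 1) → Fin r ⊕ Fin s := fun i => .inl (Fin.castLE hK i)
  have hx : Function.Injective x := fun i j h => Fin.castLE_injective hK (Sum.inl_injective h)
  -- The path runs periodically through `K + 1` distinct even letters, reversed to match the order
  -- in which the operators act.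
  let c : ℕ → Fin r ⊕ Fin s := fun k => x (Fin.rev (Fin.ofNat (K + 1) k))
  let l := x 0
  let g : ℕ → Fin r ⊕ Fin s → Grassmann F := fun n =>
    match n with
    | 0 => Pi.single l 1
    | 1 => Pi.single l 1
    | n + 2 => Pi.single (x (Fin.ofNat (K + 1) n)) 1
  have hsingle : ∀ i a, (Pi.single (x i) 1 : Fin r ⊕ Fin s → Grassmann F) a ∈
      Grassmann.part F (genParity a) := by
    intro i a
    by_cases h : a = x i
    · subst h
      rw [Pi.single_eq_same]
      exact Grassmann.one_mem
    · rw [Pi.single_eq_of_ne h]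
      exact zero_mem _
  have hg : ∀ n a, g n a ∈ Grassmann.part F (genParity a) := by
    rintro (_ | _ | n) a
    · exact hsingle 0 a
    · exact hsingle 0 a
    · exact hsingle _ a
  have h' := PathSpace.standardPoly_pow_eq_zero_of_satisfies c l hf g hg
    (fun a ha => Pi.single_eq_of_ne ha _) (fun a ha => Pi.single_eq_of_ne ha _)
  have h0 : g 0 l * g 1 l = 1 := by
    simp only [g, Pi.single_eq_same, mul_one]
  rw [h0] at h'
  have key : ∀ t, (standardPoly F (Module.End F (Grassmann F ⊗[F] PathSpace F c l)) (K + 1) (fun i => LinearMap.mulLeft F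
      (∑ a, g ((i : ℕ) + 2) a ⊗ₜ[F] (PathSpace.letter c l a : PathSpace F c l))) ^ t)
        (1 ⊗ₜ[F] PathSpace.vertex c l 0) = 1 ⊗ₜ[F] PathSpace.vertex c l (t * (K + 1)) := by
    intro t
    induction t with
    | zero => simp
    | succ t ih =>
      rw [pow_succ', Module.End.mul_apply, ih, PathSpace.standardPoly_vertex _
        (fun i k => g ((i : ℕ) + 2) (c k)) fun i h k => PathSpace.mulLeft_vertex _ h k]
      -- Each variable is a single letter, so only the identity permutation follows the path.
      have h1 : ∀ (σ : Equiv.Perm (Fin (K + 1))) (i : Fin (K + 1)),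
          g ((σ i : ℕ) + 2) (c (t * (K + 1) + i.rev)) = if σ i = i then 1 else 0 := by
        intro σ i
        have h2 : Fin.ofNat (K + 1) (t * (K + 1) + i.rev) = i.rev := by
          ext
          rw [Fin.val_ofNat, Nat.mul_add_mod_self_right, Nat.mod_eq_of_lt i.rev.is_lt]
        have h3 : Fin.ofNat (K + 1) (σ i : ℕ) = σ i := Fin.ofNat_val_eq_self _
        simp only [g, c, h2, h3, Fin.rev_rev, Pi.single_apply, hx.eq_iff, eq_comm]
      simp only [h1]
      rw [sum_sign_smul_prod_ite, one_mul, Nat.succ_mul]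
  rw [key] at h'
  exact tmul_ne_zero one_ne_zero (PathSpace.vertex_ne_zero _) h'

/-- `hookPoly` with at most `s` columns is not an identity of the free metabelian superalgebra. -/
theorem not_satisfies_of_odd [CharZero F] {K L : ℕ} (hK : 0 < K) (hL : L + 1 ≤ s) :
    ¬ (free (metabelian F) r s).envelope.Satisfies (hookPoly F K (L + 1)) := by
  intro hf
  let x : Fin (L + 1) → Fin r ⊕ Fin s := fun i => .inr (Fin.castLE hL i)
  -- Each odd letter labels a block of `K` consecutive steps. The word has `L + 1` blocks, so the
  -- reduction in `Fin.ofNat` never takes effect.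
  let c : ℕ → Fin r ⊕ Fin s := fun k => x (Fin.ofNat (L + 1) (k / K))
  let l := x 0
  -- Generators 0 and 1 serve `x₀` and `x₁`. Block `b` uses the indices `2 + K * b + n` with `n <
  -- K`, so different blocks use disjoint sets of generators.
  let g : ℕ → Fin r ⊕ Fin s → Grassmann F := fun n =>
    match n with
    | 0 => Pi.single l (Grassmann.gen F 0)
    | 1 => Pi.single l (Grassmann.gen F 1)
    | n + 2 => Sum.elim 0 (fun b => Grassmann.gen F (2 + K * b + n))
  have hsingle : ∀ i a, (Pi.single l (Grassmann.gen F i) : Fin r ⊕ Fin s → Grassmann F) a ∈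
      Grassmann.part F (genParity a) := by
    intro i a
    by_cases h : a = l
    · subst h
      rw [Pi.single_eq_same]
      exact Grassmann.gen_mem i
    · rw [Pi.single_eq_of_ne h]
      exact zero_mem _
  have hg : ∀ n a, g n a ∈ Grassmann.part F (genParity a) := by
    rintro (_ | _ | n) a
    · exact hsingle 0 a
    · exact hsingle 1 a
    · cases a
      · exact zero_mem _
      · exact Grassmann.gen_mem _
  have h' := PathSpace.standardPoly_pow_eq_zero_of_satisfies c l hf g hg
    (fun a ha => Pi.single_eq_of_ne ha _) (fun a ha => Pi.single_eq_of_ne ha _)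
  have h0 : g 0 l * g 1 l = Grassmann.gen F 0 * Grassmann.gen F 1 := by
    simp only [g, Pi.single_eq_same]
  rw [h0] at h'
  -- The list `w` records the generators used so far; the bound on its entries makes those of the
  -- next block new. Each block contributes a factor `K!`, nonzero in characteristic 0.
  have key : ∀ t ≤ L + 1, ∃ w : List ℕ, w.Nodup ∧ (∀ n ∈ w, n < 2 + K * t) ∧
      (standardPoly F (Module.End F (Grassmann F ⊗[F] PathSpace F c l)) K (fun i => LinearMap.mulLeft F
        (∑ a, g ((i : ℕ) + 2) a ⊗ₜ[F] (PathSpace.letter c l a : PathSpace F c l))) ^ t)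
          ((Grassmann.gen F 0 * Grassmann.gen F 1) ⊗ₜ[F] PathSpace.vertex c l 0) =
        (((K.factorial : F) ^ t) • (w.map (Grassmann.gen F)).prod) ⊗ₜ[F]
          PathSpace.vertex c l (t * K) := by
    intro t
    induction t with
    | zero =>
      intro _
      refine ⟨[0, 1], by decide, by simp, by simp⟩
    | succ t ih =>
      intro ht
      obtain ⟨w, hw, hwt, ih⟩ := ih (by omega)
      refine ⟨(List.ofFn fun i : Fin K => 2 + K * t + (i : ℕ)) ++ w, ?_, ?_, ?_⟩
      · rw [List.nodup_append]
        refine ⟨List.nodup_ofFn.2 fun i j hij => Fin.ext (Nat.add_left_cancel hij), hw, ?_⟩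
        intro a ha b hb
        obtain ⟨i, rfl⟩ := List.mem_ofFn.1 ha
        have := hwt b hb
        omega
      · intro n hn
        rw [Nat.mul_succ]
        rcases List.mem_append.1 hn with hn | hn
        · obtain ⟨i, rfl⟩ := List.mem_ofFn.1 hn
          have := i.is_lt
          omega
        · have := hwt n hn
          omega
      · rw [pow_succ', Module.End.mul_apply, ih, PathSpace.standardPoly_vertex _
          (fun i k => g ((i : ℕ) + 2) (c k)) fun i h k => PathSpace.mulLeft_vertex _ h k]
        have h1 : ∀ (σ : Equiv.Perm (Fin K)) (i : Fin K),
            g ((σ i : ℕ) + 2) (c (t * K + i.rev)) =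
              Grassmann.gen F (2 + K * t + (σ i : ℕ)) := by
          intro σ i
          have h2 : (t * K + i.rev) / K = t := by
            rw [mul_comm, Nat.mul_add_div hK, Nat.div_eq_of_lt i.rev.is_lt, add_zero]
          have h3 : (Fin.ofNat (L + 1) t : ℕ) = t := Nat.mod_eq_of_lt ht
          simp only [g, c, h2, x, Sum.elim_inr, Fin.val_castLE, h3]
        simp only [h1]
        rw [sum_sign_smul_prod_gen F K fun i => 2 + K * t + (i : ℕ), List.map_append,
          List.prod_append, List.map_ofFn, smul_mul_smul_comm, ← pow_succ', Nat.succ_mul]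
        rfl
  obtain ⟨w, hw, _, hval⟩ := key (L + 1) le_rfl
  rw [hval] at h'
  refine tmul_ne_zero (smul_ne_zero (pow_ne_zero _ ?_) (Grassmann.list_prod_ne_zero hw))
    (PathSpace.vertex_ne_zero _) h'
  exact Nat.cast_ne_zero.2 (Nat.factorial_ne_zero K)

end PathAlgebra

/-! ### Comparison of levels. -/

section Spectrum

variable {F : Type u} [Field F]

theorem le_of_level_eq [CharZero F] {r s : ℕ} {p : ℕ × ℕ}
    (h : level (varietyGenerated (free (metabelian F) r s).envelope) p =
      superClass (varietyGenerated (free (metabelian F) r s).envelope)) :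
    (r, s) ≤ p := by
  obtain ⟨r', s'⟩ := p
  have hN : varietyGenerated (free (metabelian F) r s).envelope ⊆ metabelian F :=
    varietyGenerated_subset isVariety_metabelian
      (envelope_mem_metabelian (free_metabelian subset_rfl r s))
  have hA : free (metabelian F) r s ∈
      level (varietyGenerated (free (metabelian F) r s).envelope) (r', s') := by
    rw [h]
    exact mem_varietyGenerated_self _
  -- Lying in the level of `(r', s')`, the envelope inherits every identity of the envelope of the
  -- free superalgebra on `r'` even and `s'` odd generators. The pair `(0, 0)` is separate, its
  -- level consisting of zero superalgebras.
  have key : ∀ K L, L * r' + K * s' < K * L →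
      (free (metabelian F) r s).envelope.Satisfies (hookPoly F K L) := by
    intro K L hKL
    unfold level at hA
    split_ifs at hA with h0
    · have hA' : Subsingleton (free (metabelian F) r s).carrier := hA
      rw [SuperAlg.envelope_satisfies_iff]
      intro v _
      exact Subsingleton.elim _ _
    · rw [supervarietyGenerated_eq] at hA
      have hA' : (free (metabelian F) r s).envelope ∈ varietyGenerated _ := hA
      rw [varietyGenerated_eq] at hA'
      exact hA' _ (satisfies_hookPoly (free_metabelian hN r' s') hKL _ (free_part_le _ r' s'))
  constructor
  · by_contra hr
    -- With `K = r' + 1` the counting inequality reduces to `K * s' < L`, and this is the least such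
    -- `L`.
    refine not_satisfies_of_even (s' * (r' + 1) + 1) (not_le.1 hr)
      (key (r' + 1) (s' * (r' + 1) + 1) ?_)
    ring_nf
    omega
  · by_contra hs
    -- Symmetrically, with `L = s' + 1` the inequality reduces to `L * r' < K`.
    refine not_satisfies_of_odd (K := r' * (s' + 1) + 1) (Nat.succ_pos _) (not_le.1 hs)
      (key (r' * (s' + 1) + 1) (s' + 1) ?_)
    ring_nf
    omega

end Spectrum
end Superrank

theorem mainTheorem7 {F : Type u} [Field F] [CharZero F] (r s : ℕ) (hrs : (r, s) ≠ (0, 0)) :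
    Superrank.basicSpectrum
      (Superrank.varietyGenerated (Superrank.free (Superrank.metabelian F) r s).envelope) =
        {(r, s)} := by
  have hlevel : Superrank.level
      (Superrank.varietyGenerated (Superrank.free (Superrank.metabelian F) r s).envelope) (r, s) =
      Superrank.superClass
        (Superrank.varietyGenerated (Superrank.free (Superrank.metabelian F) r s).envelope) := by
    rw [Superrank.level, if_neg hrs, Superrank.free_varietyGenerated,
      Superrank.supervarietyGenerated_eq]
  refine Set.ext fun p => ⟨fun hp => ?_, ?_⟩
  · have hp' := Superrank.le_of_level_eq hp.1
    exact le_antisymm (hp.2 hlevel hp') hp'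
  · rintro rfl
    exact ⟨hlevel, fun q hq _ => Superrank.le_of_level_eq hq⟩
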